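/- Let $n\ge 2$ and $0\le k\le m$ be integers. Tensors on $\mathbb R^n$ are complex and are written through their components in the standard orthonormal basis, with summation over repeated indices; $S^m$ is the space of symmetric tensors of rank $m$, and $\mathcal S(\mathbb R^n;S^m)$ is the space of symmetric rank $m$ tensor fields whose components are Schwartz functions. **Notation.** - For a tensor $v$ of rank $r+q$ and a tensor $u$ of rank $q$, the contraction $v/u=j_uv$ is $(v/u)_{i_1\dots i_r}=v_{i_1\dots i_r j_1\dots j_q}u^{j_1\dots j_q}$. In particular, $j_y$ is the contraction with the vector $y\in\mathbb R^n$. - The inner derivative of a symmetric tensor field $u$ of rank $p$ is the symmetric field of rank $p+1$ given by $(du)_{i_1\dots i_{p+1}}=\sigma\,\partial u_{i_1\dots i_p}/\partial x^{i_{p+1}}$, where $\sigma$ is the symmetrization in $i_1,\dots,i_{p+1}$. - The Fourier transform is $\widehat f(y)=(2\pi)^{-n/2}\int_{\mathbb R^n}e^{-\mathrm i\langle y,x\rangle}f(x)\,dx$, applied componentwise to tensor fields and extended to tempered distributions by duality. - $T\mathbb S^{n-1}=\{(x,\xi)\in\mathbb R^n\times\mathbb R^n:\ |\xi|=1,\ \langle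 x,\xi\rangle=0\}$. For $f\in\mathcal S(\mathbb R^n;S^m)$, the momentum ray transform of $f$ is the function on $T\mathbb S^{n-1}$ $$I_m^kf(x,\xi)=\int_{\mathbb R}t^k f_{i_1\dots i_m}(x+t\xi)\,\xi^{i_1}\cdots\xi^{i_m}\,dt .$$ Its formal $L^2$-adjoint is $$\big((I_m^k)^*\varphi\big)_{i_1\dots i_m}(x)=\int_{\mathbb S^{n-1}}\langle x,\xi\rangle^k\,\xi_{i_1}\cdots\xi_{i_m}\,\varphi\big(x-\langle x,\xi\rangle\xi,\xi\big)\,d\xi ,$$ where $d\xi$ is the surface measure of the unit sphere, and $N_m^k=(I_m^k)^*I_m^k$ is the normal operator. - For $y\in\mathbb R^n\setminus\{0\}$, $A^{(m,k)}(y)=d^{2m-k}|y|^{2m-2k-1}$, a symmetric tensor of rank $2m-k$. **Proposition.** Let $f\in\mathcal S(\mathbb R^n;S^m)$. Then $N_m^kf$ defines a tempered tensor field-distribution, the restriction of its Fourier transform $\widehat{N_m^kf}$ to $\mathbb R^n\setminus\{0\}$ belongs to $C^\infty(\mathbb R^n\setminus\{0\};S^m)$, and, with $$F^{(m,k)}(y)=\frac{2^{m-2}\,(2m-1)!!\,\Gamma\big(\frac{2m+n-1}{2}\big)}{\pi^{(n+1)/2}\,k!}\;j_y^k\,\widehat{N_m^kf}(y)\qquad(y\ne0)$$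 (where $(-1)!!=1$), the following equality holds: $$\big(A^{(m,0)}/(d^k\widehat f\,)\big)(y)=F^{(m,k)}(y)\qquad\text{for all }y\in\mathbb R^n\setminus\{0\}.$$ -/

import Mathlib

open scoped SchwartzMap FourierTransform ContDiff

noncomputable section

namespace MomentumRay

/-- The Euclidean space `ℝⁿ`. -/
abbrev Euc (n : ℕ) : Type := EuclideanSpace ℝ (Fin n)

/-- The complex vector space `T^m ℝⁿ` of rank `m` tensors on `ℝⁿ`: a tensor is the family
of its components `u_{i₁…i_m}` in the standard orthonormal basis. -/
abbrev Tensor (n m : ℕ) : Type := (Fin m → Fin n) → ℂ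

variable {n m : ℕ}

/-! ### Tensor algebra -/

/-- The components are symmetric in all indices. It is stated for families with values in any
type, so that it applies to tensors, to Schwartz tensor fields and to tensor distributions. -/
def IsSymm {α : Type} (u : (Fin m → Fin n) → α) : Prop :=
  ∀ (π : Equiv.Perm (Fin m)) (i : Fin m → Fin n), u (i ∘ π) = u i

/-- The symmetrization `σ : T^m → S^m` in all indices. -/
def symmetrize (u : Tensor n m) : Tensor n m :=
  fun i => ((m.factorial : ℂ))⁻¹ * ∑ π : Equiv.Perm (Fin m), u (i ∘ π)

/-- The contraction `v / u = j_u v`,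
`(v / u)_{i₁…i_r} = v_{i₁…i_r j₁…j_q} u^{j₁…j_q}`, for `v` of rank `p = r + q`. -/
def contract {p q r : ℕ} (h : r + q = p) (v : Tensor n p) (u : Tensor n q) : Tensor n r :=
  fun i => ∑ j : Fin q → Fin n, v (Fin.append i j ∘ Fin.cast h.symm) * u j

/-- The contraction `j_y` with a vector `y ∈ ℝⁿ` regarded as a tensor of rank one. -/
def contractVec {r : ℕ} (y : Euc n) (v : Tensor n (r + 1)) : Tensor n r :=
  contract rfl v (fun j : Fin 1 → Fin n => ((y (j 0) : ℝ) : ℂ))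

/-- The `k`-th power `j_y^k`. -/
def contractVecPow {r : ℕ} (y : Euc n) : (k : ℕ) → Tensor n (r + k) → Tensor n r
  | 0, v => v
  | k + 1, v => contractVecPow y k (contractVec (r := r + k) y v)

/-- The identification of tensors of ranks `p` and `q` when `p = q`. -/
def castRank {p q : ℕ} (h : p = q) (v : Tensor n p) : Tensor n q :=
  fun i => v (i ∘ Fin.cast h)

/-! ### The inner derivative -/

/-- The partial derivative `∂u/∂x^j`. -/
def partialDeriv (j : Fin n) (u : Euc n → ℂ) (x : Euc n) : ℂ :=
  fderiv ℝ u x (EuclideanSpace.single j (1 : ℝ))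

/-- The inner derivative `(d u)_{i₁…i_{m+1}} = σ(i₁…i_{m+1}) ∂u_{i₁…i_m}/∂x^{i_{m+1}}`. -/
def innerDeriv (u : Euc n → Tensor n m) : Euc n → Tensor n (m + 1) :=
  fun x => symmetrize fun i : Fin (m + 1) → Fin n =>
    partialDeriv (i (Fin.last m)) (fun z => u z (Fin.init i)) x

/-- The `k`-th power `d^k` of the inner derivative. -/
def innerDerivPow : (k : ℕ) → (Euc n → Tensor n m) → Euc n → Tensor n (m + k)
  | 0, u => u
  | k + 1, u => innerDeriv (innerDerivPow k u)

/-- The tensor field `A^{(m,k)}(y) = d^{2m-k} |y|^{2m-2k-1}` of rank `2m - k`. -/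
def tensorA (n m k : ℕ) (y : Euc n) : Tensor n (2 * m - k) :=
  castRank (zero_add _) (innerDerivPow (m := 0) (2 * m - k)
    (fun z _ => ((‖z‖ ^ (2 * (m : ℤ) - 2 * (k : ℤ) - 1) : ℝ) : ℂ)) y)

/-! ### The Fourier transform -/

/-- The linear dilation `y ↦ y / (2π)`. -/
def dilation (n : ℕ) : Euc n ≃L[ℝ] Euc n :=
  ContinuousLinearEquiv.smulLeft
    (Units.mk0 ((2 * Real.pi)⁻¹ : ℝ) (inv_ne_zero Real.two_pi_pos.ne'))

/-- The Fourier transform on the Schwartz space normalized as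
`φ̂(y) = (2π)^{-n/2} ∫ e^{-i⟨y,x⟩} φ(x) dx` (see `fourier_apply`). -/
def fourier (n : ℕ) : 𝓢(Euc n, ℂ) →L[ℂ] 𝓢(Euc n, ℂ) :=
  (((2 * Real.pi) ^ (-(n : ℝ) / 2) : ℝ) : ℂ) •
    ((SchwartzMap.compCLMOfContinuousLinearEquiv ℂ (dilation n)).comp
      (FourierTransform.fourierCLM ℂ 𝓢(Euc n, ℂ)))

theorem fourier_apply (φ : 𝓢(Euc n, ℂ)) (y : Euc n) :
    fourier n φ y = (((2 * Real.pi) ^ (-(n : ℝ) / 2) : ℝ) : ℂ) *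
      ∫ x : Euc n, Complex.exp (-Complex.I * ((inner ℝ y x : ℝ) : ℂ)) * φ x := by
  have h : fourier n φ y = (((2 * Real.pi) ^ (-(n : ℝ) / 2) : ℝ) : ℂ) *
      (𝓕 φ) ((2 * Real.pi)⁻¹ • y) := rfl
  rw [h, SchwartzMap.fourier_coe, Real.fourier_eq']
  congr 1
  refine MeasureTheory.integral_congr_ae (Filter.Eventually.of_forall fun x => ?_)
  have hpi : (Real.pi : ℂ) ≠ 0 := by exact_mod_cast Real.pi_ne_zero
  simp only [smul_eq_mul, real_inner_smul_right, real_inner_comm]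
  congr 2
  push_cast
  field_simp

/-- The Fourier transform of a tempered distribution, `⟨û, φ⟩ = ⟨u, φ̂⟩`. -/
def fourierDistribution (u : 𝓢'(Euc n, ℂ)) : 𝓢'(Euc n, ℂ) :=
  PointwiseConvergenceCLM.precomp ℂ (fourier n) u

/-- The tempered distribution `U` is the one defined by the function `u`. -/
def IsDefinedBy (U : 𝓢'(Euc n, ℂ)) (u : Euc n → ℂ) : Prop :=
  ∀ φ : 𝓢(Euc n, ℂ), MeasureTheory.Integrable (fun x => u x * φ x) ∧
    U φ = ∫ x : Euc n, u x * φ x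

/-- The restriction of the tempered distribution `U` to the open set `ℝⁿ ∖ {0}` is the
distribution defined there by the function `g`. -/
def RestrictsOffOriginTo (U : 𝓢'(Euc n, ℂ)) (g : Euc n → ℂ) : Prop :=
  ∀ φ : 𝓢(Euc n, ℂ), HasCompactSupport φ → tsupport φ ⊆ {0}ᶜ →
    MeasureTheory.Integrable (fun x => g x * φ x) ∧ U φ = ∫ x : Euc n, g x * φ x

/-! ### The momentum ray transform and its normal operator -/

/-- `T𝕊^{n-1} = {(x, ξ) : |ξ| = 1, ⟨x, ξ⟩ = 0}`, the manifold of oriented lines in `ℝⁿ`. -/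
abbrev TSphere (n : ℕ) : Type :=
  {p : Euc n × Euc n // ‖p.2‖ = 1 ∧ (inner ℝ p.1 p.2 : ℝ) = 0}

/-- The line through `x` in the direction `ξ`, that is, the point `(x - ⟨x, ξ⟩ ξ, ξ)`. -/
def lineThrough (x : Euc n) (ξ : Metric.sphere (0 : Euc n) 1) : TSphere n :=
  ⟨(x - (inner ℝ x (ξ : Euc n) : ℝ) • (ξ : Euc n), (ξ : Euc n)), by
    have h : ‖(ξ : Euc n)‖ = 1 := by simp
    refine ⟨h, ?_⟩
    simp [inner_sub_left, real_inner_smul_left, h]⟩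

/-- The momentum ray transform
`I_m^k f(x, ξ) = ∫ t^k f_{i₁…i_m}(x + tξ) ξ^{i₁} ⋯ ξ^{i_m} dt`. -/
def momentumRay (k : ℕ) (f : (Fin m → Fin n) → 𝓢(Euc n, ℂ)) (p : TSphere n) : ℂ :=
  ∫ t : ℝ, (t : ℂ) ^ k *
    ∑ i : Fin m → Fin n, f i (p.1.1 + t • p.1.2) * ∏ a, ((p.1.2 (i a) : ℝ) : ℂ)

/-- The formal `L²`-adjoint of `I_m^k`:
`((I_m^k)^* φ)_{i₁…i_m}(x) = ∫_{𝕊^{n-1}} ⟨x, ξ⟩^k ξ_{i₁} ⋯ ξ_{i_m} φ(x - ⟨x, ξ⟩ ξ, ξ) dξ`,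
where `dξ` is the surface measure of the unit sphere. -/
def momentumRayAdjoint (m k : ℕ) (φ : TSphere n → ℂ) (x : Euc n) : Tensor n m :=
  fun i => ∫ ξ : Metric.sphere (0 : Euc n) 1,
    ((inner ℝ x (ξ : Euc n) : ℝ) : ℂ) ^ k * (∏ a, (((ξ : Euc n) (i a) : ℝ) : ℂ)) *
      φ (lineThrough x ξ) ∂(MeasureTheory.volume : MeasureTheory.Measure (Euc n)).toSphere

/-- The normal operator `N_m^k = (I_m^k)^* I_m^k`. -/
def normalOp (k : ℕ) (f : (Fin m → Fin n) → 𝓢(Euc n, ℂ)) : Euc n → Tensor n m :=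
  momentumRayAdjoint m k (momentumRay k f)

/-- The tensor field
`F^{(m,k)}(y) = 2^{m-2} (2m-1)!! Γ((2m+n-1)/2) / (π^{(n+1)/2} k!) j_y^k G(y)`
of rank `m - k`, to be used with `G` the Fourier transform of `N_m^k f`. For `m = 0` the natural
number `2 * m - 1` is `0`, and `0‼ = 1` is the value of `(-1)!!`. -/
def tensorF {k : ℕ} (hk : k ≤ m) (G : Euc n → Tensor n m) (y : Euc n) : Tensor n (m - k) :=
  (((2 : ℝ) ^ ((m : ℤ) - 2) * (Nat.doubleFactorial (2 * m - 1) : ℝ) *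
      Real.Gamma ((2 * (m : ℝ) + (n : ℝ) - 1) / 2) /
    (Real.pi ^ (((n : ℝ) + 1) / 2) * (k.factorial : ℝ)) : ℝ) : ℂ) •
    contractVecPow y k (castRank (Nat.sub_add_cancel hk).symm (G y))

end MomentumRay

end

noncomputable section

namespace MomentumRay

open scoped LineDeriv

variable {n m : ℕ}

/-! ### Partial derivatives away from the origin -/

/-- The function `u` is smooth on `ℝⁿ ∖ {0}`. -/
def SmoothOff (u : Euc n → ℂ) : Prop := ContDiffOn ℝ ∞ u {0}ᶜ

theorem isOpen_off : IsOpen ({0}ᶜ : Set (Euc n)) := isOpen_compl_singleton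

theorem SmoothOff.contDiffAt {u : Euc n → ℂ} (h : SmoothOff u) {y : Euc n} (hy : y ≠ 0) :
    ContDiffAt ℝ ∞ u y :=
  ContDiffOn.contDiffAt h (isOpen_off.mem_nhds hy)

theorem SmoothOff.differentiableAt {u : Euc n → ℂ} (h : SmoothOff u) {y : Euc n} (hy : y ≠ 0) :
    DifferentiableAt ℝ u y :=
  (h.contDiffAt hy).differentiableAt (by simp)

theorem _root_.ContDiff.smoothOff {u : Euc n → ℂ} (h : ContDiff ℝ ∞ u) : SmoothOff u := h.contDiffOn

theorem smoothOff_const (c : ℂ) : SmoothOff (fun _ : Euc n => c) := contDiffOn_const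

theorem contDiff_coord (i : Fin n) : ContDiff ℝ ∞ (fun y : Euc n => ((y i : ℝ) : ℂ)) :=
  Complex.ofRealCLM.contDiff.comp (EuclideanSpace.proj (𝕜 := ℝ) i).contDiff

theorem SmoothOff.mul {u v : Euc n → ℂ} (hu : SmoothOff u) (hv : SmoothOff v) :
    SmoothOff (fun y => u y * v y) := ContDiffOn.mul hu hv

theorem SmoothOff.sum {ι : Type*} {s : Finset ι} {u : ι → Euc n → ℂ}
    (hu : ∀ i ∈ s, SmoothOff (u i)) : SmoothOff (fun y => ∑ i ∈ s, u i y) :=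
  ContDiffOn.sum hu

theorem SmoothOff.partialDeriv {u : Euc n → ℂ} (hu : SmoothOff u) (i : Fin n) :
    SmoothOff (partialDeriv i u) := by
  have h : ContDiffOn ℝ ∞ (fderiv ℝ u) {0}ᶜ :=
    ContDiffOn.fderiv_of_isOpen hu isOpen_off (by simp)
  exact h.clm_apply contDiffOn_const

theorem partialDeriv_congr {u v : Euc n → ℂ} (h : ∀ y ≠ 0, u y = v y) (i : Fin n) {y : Euc n}
    (hy : y ≠ 0) : partialDeriv i u y = partialDeriv i v y := by
  have : u =ᶠ[nhds y] v := Filter.eventuallyEq_of_mem (isOpen_off.mem_nhds hy) h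
  rw [partialDeriv, partialDeriv, this.fderiv_eq]

theorem partialDeriv_const (c : ℂ) (i : Fin n) (y : Euc n) :
    partialDeriv i (fun _ => c) y = 0 := by
  simp [partialDeriv]

theorem partialDeriv_coord (i j : Fin n) (y : Euc n) :
    partialDeriv i (fun z : Euc n => ((z j : ℝ) : ℂ)) y = if j = i then 1 else 0 := by
  have h : HasFDerivAt (fun z : Euc n => ((z j : ℝ) : ℂ))
      (Complex.ofRealCLM.comp (EuclideanSpace.proj (𝕜 := ℝ) j)) y :=
    (Complex.ofRealCLM.comp (EuclideanSpace.proj (𝕜 := ℝ) j)).hasFDerivAt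
  rw [partialDeriv, h.fderiv]
  by_cases hji : j = i <;> simp [hji]

theorem partialDeriv_mul {u v : Euc n → ℂ} {y : Euc n} (hu : DifferentiableAt ℝ u y)
    (hv : DifferentiableAt ℝ v y) (i : Fin n) :
    partialDeriv i (fun z => u z * v z) y = u y * partialDeriv i v y + v y * partialDeriv i u y := by
  simp only [partialDeriv]
  rw [fderiv_fun_mul hu hv]
  simp

theorem partialDeriv_const_mul {u : Euc n → ℂ} {y : Euc n} (hu : DifferentiableAt ℝ u y)
    (c : ℂ) (i : Fin n) :
    partialDeriv i (fun z => c * u z) y = c * partialDeriv i u y := by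
  rw [partialDeriv_mul (differentiableAt_const c) hu, partialDeriv_const, mul_zero, add_zero]

theorem partialDeriv_sum {ι : Type*} {s : Finset ι} {u : ι → Euc n → ℂ} {y : Euc n}
    (hu : ∀ i ∈ s, DifferentiableAt ℝ (u i) y) (j : Fin n) :
    partialDeriv j (fun z => ∑ i ∈ s, u i z) y = ∑ i ∈ s, partialDeriv j (u i) y := by
  simp only [partialDeriv]
  rw [fderiv_fun_sum hu]
  simp

theorem partialDeriv_comm {u : Euc n → ℂ} (hu : SmoothOff u) {y : Euc n} (hy : y ≠ 0)
    (i j : Fin n) :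
    partialDeriv i (partialDeriv j u) y = partialDeriv j (partialDeriv i u) y := by
  have hd : DifferentiableAt ℝ (fderiv ℝ u) y :=
    ((hu.contDiffAt hy).fderiv_right (m := 1) (by norm_cast)).differentiableAt (by simp)
  have key : ∀ a b : Fin n, partialDeriv a (partialDeriv b u) y =
      fderiv ℝ (fderiv ℝ u) y (EuclideanSpace.single a 1) (EuclideanSpace.single b 1) := by
    intro a b
    have : partialDeriv b u = fun z => fderiv ℝ u z (EuclideanSpace.single b (1 : ℝ)) := rfl
    rw [this, partialDeriv, fderiv_clm_apply hd (differentiableAt_const _)]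
    simp
  rw [key, key]
  exact ((hu.contDiffAt hy).isSymmSndFDerivAt (by simp only [minSmoothness_of_isRCLikeNormedField]; norm_cast)).eq _ _

/-- The iterated partial derivative `∂_{i₁} ⋯ ∂_{i_r} u`, the indices being given by a list. -/
def iterDeriv : List (Fin n) → (Euc n → ℂ) → Euc n → ℂ
  | [], u => u
  | i :: R, u => partialDeriv i (iterDeriv R u)

@[simp] theorem iterDeriv_nil (u : Euc n → ℂ) : iterDeriv [] u = u := rfl

theorem iterDeriv_cons (i : Fin n) (R : List (Fin n)) (u : Euc n → ℂ) :
    iterDeriv (i :: R) u = partialDeriv i (iterDeriv R u) := rfl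

theorem iterDeriv_append (R R' : List (Fin n)) (u : Euc n → ℂ) :
    iterDeriv (R ++ R') u = iterDeriv R (iterDeriv R' u) := by
  induction R with
  | nil => rfl
  | cons i R ih => rw [List.cons_append, iterDeriv_cons, ih, iterDeriv_cons]

theorem SmoothOff.iterDeriv {u : Euc n → ℂ} (hu : SmoothOff u) (R : List (Fin n)) :
    SmoothOff (iterDeriv R u) := by
  induction R with
  | nil => exact hu
  | cons i R ih => exact ih.partialDeriv i

theorem iterDeriv_congr {u v : Euc n → ℂ} (h : ∀ y ≠ 0, u y = v y) (R : List (Fin n)) {y : Euc n}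
    (hy : y ≠ 0) : MomentumRay.iterDeriv R u y = MomentumRay.iterDeriv R v y := by
  induction R generalizing y with
  | nil => exact h y hy
  | cons i R ih => exact partialDeriv_congr (fun z hz => ih hz) i hy

theorem iterDeriv_perm {u : Euc n → ℂ} (hu : SmoothOff u) {R R' : List (Fin n)}
    (h : R.Perm R') {y : Euc n} (hy : y ≠ 0) :
    MomentumRay.iterDeriv R u y = MomentumRay.iterDeriv R' u y := by
  induction h generalizing y with
  | nil => rfl
  | cons i _ ih => exact partialDeriv_congr (fun z hz => ih hz) i hy
  | swap i j R => exact partialDeriv_comm (hu.iterDeriv R) hy j i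
  | trans _ _ ih₁ ih₂ => exact (ih₁ hy).trans (ih₂ hy)

theorem iterDeriv_const_mul {u : Euc n → ℂ} (hu : SmoothOff u) (c : ℂ) (R : List (Fin n))
    {y : Euc n} (hy : y ≠ 0) :
    MomentumRay.iterDeriv R (fun z => c * u z) y = c * MomentumRay.iterDeriv R u y := by
  induction R generalizing y with
  | nil => rfl
  | cons i R ih =>
    rw [iterDeriv_cons, partialDeriv_congr (fun z hz => ih hz) i hy,
      partialDeriv_const_mul ((hu.iterDeriv R).differentiableAt hy)]
    rfl

theorem iterDeriv_sum {ι : Type*} {s : Finset ι} {u : ι → Euc n → ℂ}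
    (hu : ∀ i ∈ s, SmoothOff (u i)) (R : List (Fin n)) {y : Euc n} (hy : y ≠ 0) :
    MomentumRay.iterDeriv R (fun z => ∑ i ∈ s, u i z) y =
      ∑ i ∈ s, MomentumRay.iterDeriv R (u i) y := by
  induction R generalizing y with
  | nil => rfl
  | cons i R ih =>
    rw [iterDeriv_cons, partialDeriv_congr (fun z hz => ih hz) i hy,
      partialDeriv_sum fun j hj => ((hu j hj).iterDeriv R).differentiableAt hy]
    rfl

/-! ### Symmetric tensor fields of arbitrary rank, indexed by lists -/

/-- A family of functions indexed by lists of indices, symmetric and smooth off the origin. -/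
structure SymField (S : List (Fin n) → Euc n → ℂ) : Prop where
  perm : ∀ {R R' : List (Fin n)}, R.Perm R' → ∀ y ≠ 0, S R y = S R' y
  smooth : ∀ R, SmoothOff (S R)

/-- The divergence `∂^l S_{l X}`. -/
def divField (S : List (Fin n) → Euc n → ℂ) (X : List (Fin n)) (y : Euc n) : ℂ :=
  ∑ l, partialDeriv l (S (l :: X)) y

/-- The contraction `y^l S_{l X}` with the position vector. -/
def posField (S : List (Fin n) → Euc n → ℂ) (X : List (Fin n)) (y : Euc n) : ℂ :=
  ∑ l, ((y l : ℝ) : ℂ) * S (l :: X) y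

/-- The trace `S_{l l X}`. -/
def trField (S : List (Fin n) → Euc n → ℂ) (X : List (Fin n)) (y : Euc n) : ℂ :=
  ∑ l, S (l :: l :: X) y

theorem SymField.divField {S : List (Fin n) → Euc n → ℂ} (h : SymField S) :
    SymField (divField S) where
  perm hR _ hy := Finset.sum_congr rfl fun l _ =>
    partialDeriv_congr (fun z hz => h.perm (hR.cons l) z hz) l hy
  smooth _ := SmoothOff.sum fun l _ => (h.smooth _).partialDeriv l

theorem SymField.posField {S : List (Fin n) → Euc n → ℂ} (h : SymField S) :
    SymField (posField S) where
  perm hR y hy := Finset.sum_congr rfl fun l _ => by rw [h.perm (hR.cons l) y hy]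
  smooth _ := SmoothOff.sum fun l _ => (contDiff_coord l).smoothOff.mul (h.smooth _)

theorem SymField.trField {S : List (Fin n) → Euc n → ℂ} (h : SymField S) :
    SymField (trField S) where
  perm hR y hy := Finset.sum_congr rfl fun l _ => h.perm ((hR.cons l).cons l) y hy
  smooth _ := SmoothOff.sum fun _ _ => h.smooth _

theorem SymField.iterate_divField {S : List (Fin n) → Euc n → ℂ} (h : SymField S) (k : ℕ) :
    SymField (MomentumRay.divField^[k] S) := by
  induction k with
  | zero => exact h
  | succ k ih => rw [Function.iterate_succ_apply']; exact ih.divField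

theorem divField_congr {S S' : List (Fin n) → Euc n → ℂ} (h : ∀ X, ∀ y ≠ 0, S X y = S' X y)
    (X : List (Fin n)) {y : Euc n} (hy : y ≠ 0) : divField S X y = divField S' X y :=
  Finset.sum_congr rfl fun l _ => partialDeriv_congr (h _) l hy

theorem posField_congr {S S' : List (Fin n) → Euc n → ℂ} (h : ∀ X, ∀ y ≠ 0, S X y = S' X y)
    (X : List (Fin n)) {y : Euc n} (hy : y ≠ 0) : posField S X y = posField S' X y :=
  Finset.sum_congr rfl fun l _ => by rw [h _ y hy]

theorem trField_congr {S S' : List (Fin n) → Euc n → ℂ} (h : ∀ X, ∀ y ≠ 0, S X y = S' X y)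
    (X : List (Fin n)) {y : Euc n} (hy : y ≠ 0) : trField S X y = trField S' X y :=
  Finset.sum_congr rfl fun _ _ => h _ y hy

theorem iterate_posField_congr {S S' : List (Fin n) → Euc n → ℂ}
    (h : ∀ X, ∀ y ≠ 0, S X y = S' X y) (k : ℕ) (X : List (Fin n)) {y : Euc n} (hy : y ≠ 0) :
    posField^[k] S X y = posField^[k] S' X y := by
  induction k generalizing X y with
  | zero => exact h X y hy
  | succ k ih =>
    rw [Function.iterate_succ_apply', Function.iterate_succ_apply']
    exact posField_congr (fun X y hy => ih X hy) X hy

theorem iterate_posField_const_mul (c : ℂ) (S : List (Fin n) → Euc n → ℂ) (k : ℕ) :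
    posField^[k] (fun X y => c * S X y) = fun X y => c * posField^[k] S X y := by
  induction k with
  | zero => rfl
  | succ k ih =>
    rw [Function.iterate_succ_apply', Function.iterate_succ_apply', ih]
    funext X y
    simp only [posField, Finset.mul_sum]
    exact Finset.sum_congr rfl fun l _ => by ring

theorem posField_divField {S : List (Fin n) → Euc n → ℂ} (h : SymField S) (X : List (Fin n))
    {y : Euc n} (hy : y ≠ 0) :
    posField (divField S) X y = divField (posField S) X y - trField S X y := by
  have h1 : divField (posField S) X y =
      ∑ l, ((∑ i, ((y i : ℝ) : ℂ) * partialDeriv l (S (i :: l :: X)) y) + S (l :: l :: X) y) := by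
    refine Finset.sum_congr rfl fun l _ => ?_
    have := partialDeriv_sum (s := Finset.univ) (y := y)
      (u := fun i z => ((z i : ℝ) : ℂ) * S (i :: l :: X) z)
      (fun i _ => ((contDiff_coord i).smoothOff.mul (h.smooth _)).differentiableAt hy) l
    refine this.trans ?_
    rw [Finset.sum_congr rfl fun i _ => partialDeriv_mul
      ((contDiff_coord i).smoothOff.differentiableAt hy) ((h.smooth _).differentiableAt hy) l,
      Finset.sum_add_distrib]
    congr 1
    simp [partialDeriv_coord]
  rw [h1, Finset.sum_add_distrib, Finset.sum_comm, trField, add_sub_cancel_right]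
  refine Finset.sum_congr rfl fun i _ => ?_
  rw [divField, Finset.mul_sum]
  refine Finset.sum_congr rfl fun l _ => ?_
  rw [partialDeriv_congr (fun z hz => h.perm (List.Perm.swap i l X) z hz) l hy]

theorem trField_divField {S : List (Fin n) → Euc n → ℂ} (h : SymField S) (X : List (Fin n))
    {y : Euc n} (hy : y ≠ 0) :
    trField (divField S) X y = divField (trField S) X y := by
  have h1 : divField (trField S) X y = ∑ l, ∑ i, partialDeriv l (S (i :: i :: l :: X)) y :=
    Finset.sum_congr rfl fun l _ =>
      partialDeriv_sum (fun i _ => (h.smooth (i :: i :: l :: X)).differentiableAt hy) l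
  rw [h1, Finset.sum_comm]
  refine Finset.sum_congr rfl fun i _ => Finset.sum_congr rfl fun l _ => ?_
  refine partialDeriv_congr (fun z hz => h.perm ?_ z hz) l hy
  exact (List.Perm.swap i l _).trans ((List.Perm.swap i l _).cons i)

theorem posField_trField {S : List (Fin n) → Euc n → ℂ} (h : SymField S) (X : List (Fin n))
    {y : Euc n} (hy : y ≠ 0) :
    posField (trField S) X y = trField (posField S) X y := by
  simp only [posField, trField, Finset.mul_sum]
  rw [Finset.sum_comm]
  refine Finset.sum_congr rfl fun i _ => Finset.sum_congr rfl fun l _ => ?_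
  rw [h.perm (((List.Perm.swap l i X).cons i).trans (List.Perm.swap l i _)) y hy]

theorem posField_iterate_divField {S : List (Fin n) → Euc n → ℂ} (h : SymField S)
    (h0 : ∀ X, ∀ y ≠ 0, posField S X y = 0) (k : ℕ) (X : List (Fin n)) {y : Euc n} (hy : y ≠ 0) :
    posField (divField^[k + 1] S) X y = -(k + 1 : ℂ) * divField^[k] (trField S) X y := by
  have htr : ∀ (k : ℕ) (X : List (Fin n)) (y : Euc n), y ≠ 0 →
      trField (divField^[k] S) X y = divField^[k] (trField S) X y := by
    intro k
    induction k with
    | zero => intro X y _; rfl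
    | succ k ih =>
      intro X y hy
      rw [Function.iterate_succ_apply', Function.iterate_succ_apply',
        trField_divField (h.iterate_divField k) X hy]
      exact divField_congr ih X hy
  induction k generalizing X y with
  | zero =>
    rw [Function.iterate_succ_apply', Function.iterate_zero_apply, Function.iterate_zero_apply,
      posField_divField h X hy, divField_congr (S' := fun _ _ => 0) h0 X hy]
    simp [divField, partialDeriv_const]
  | succ k ih =>
    rw [Function.iterate_succ_apply', posField_divField (h.iterate_divField _) X hy,
      divField_congr (fun X y hy => ih X hy) X hy, htr _ X y hy,
      Function.iterate_succ_apply' divField k]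
    have hs := h.trField.iterate_divField k
    simp only [divField]
    rw [Finset.sum_congr rfl fun l _ =>
      partialDeriv_const_mul ((hs.smooth (l :: X)).differentiableAt hy) _ l, ← Finset.mul_sum]
    push_cast
    ring

theorem iterate_posField_iterate_divField {S : List (Fin n) → Euc n → ℂ} (h : SymField S)
    (h0 : ∀ X, ∀ y ≠ 0, posField S X y = 0) (k : ℕ) (X : List (Fin n)) {y : Euc n} (hy : y ≠ 0) :
    posField^[k] (divField^[k] S) X y = (-1) ^ k * (k.factorial : ℂ) * trField^[k] S X y := by
  induction k generalizing S X y with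
  | zero => simp
  | succ k ih =>
    rw [Function.iterate_succ_apply,
      iterate_posField_congr (fun X y hy => posField_iterate_divField h h0 k X hy) k X hy,
      iterate_posField_const_mul, Function.iterate_succ_apply, Nat.factorial_succ]
    beta_reduce
    rw [ih h.trField _ X hy]
    · push_cast
      ring
    · intro X y hy
      rw [posField_trField h X hy, trField_congr (S' := fun _ _ => 0) h0 X hy]
      simp [trField]

/-! ### Integration by parts against test functions supported off the origin -/

/-- A test function on `ℝⁿ ∖ {0}`. -/
structure IsTest (φ : Euc n → ℂ) : Prop where
  smooth : ContDiff ℝ ∞ φ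
  compact : HasCompactSupport φ
  off : tsupport φ ⊆ {0}ᶜ

theorem IsTest.partialDeriv {φ : Euc n → ℂ} (h : IsTest φ) (i : Fin n) :
    IsTest (partialDeriv i φ) := by
  have hsub : tsupport (MomentumRay.partialDeriv i φ) ⊆ tsupport φ := by
    refine (closure_mono fun y hy => ?_).trans (tsupport_fderiv_subset ℝ (f := φ))
    rw [Function.mem_support] at hy ⊢
    intro h0
    exact hy (by rw [MomentumRay.partialDeriv, h0]; rfl)
  exact ⟨(h.smooth.fderiv_right (by simp)).clm_apply contDiff_const,
    h.compact.of_isClosed_subset (isClosed_tsupport _) hsub, hsub.trans h.off⟩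

theorem IsTest.iterDeriv {φ : Euc n → ℂ} (h : IsTest φ) (R : List (Fin n)) :
    IsTest (iterDeriv R φ) := by
  induction R with
  | nil => exact h
  | cons i R ih => exact ih.partialDeriv i

theorem IsTest.continuous_mul {u φ : Euc n → ℂ} (hu : ContinuousOn u {0}ᶜ) (h : IsTest φ) :
    Continuous (fun y => u y * φ y) := by
  refine continuous_of_tsupport fun y hy => ?_
  have hy' : y ∈ tsupport φ := tsupport_mul_subset_right hy
  exact (hu.continuousAt (isOpen_off.mem_nhds (h.off hy'))).mul h.smooth.continuous.continuousAt

theorem IsTest.integrable_mul {u φ : Euc n → ℂ} (hu : ContinuousOn u {0}ᶜ) (h : IsTest φ) :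
    MeasureTheory.Integrable (fun y => u y * φ y) :=
  (h.continuous_mul hu).integrable_of_hasCompactSupport h.compact.mul_left

theorem SmoothOff.integral_partialDeriv_mul {u φ : Euc n → ℂ} (hu : SmoothOff u) (h : IsTest φ)
    (i : Fin n) :
    ∫ y, MomentumRay.partialDeriv i u y * φ y = -∫ y, u y * MomentumRay.partialDeriv i φ y := by
  have := integral_mul_fderiv_eq_neg_fderiv_mul_of_integrable (μ := MeasureTheory.volume)
    (f := u) (g := φ) (v := EuclideanSpace.single i (1 : ℝ))
    (h.integrable_mul (hu.partialDeriv i).continuousOn)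
    ((h.partialDeriv i).integrable_mul (ContDiffOn.continuousOn hu))
    (h.integrable_mul (ContDiffOn.continuousOn hu))
    (fun x hx => hu.differentiableAt (h.off hx))
    (fun x _ => (h.smooth.differentiable (by simp)) x)
  exact (neg_eq_iff_eq_neg.2 this).symm

theorem SmoothOff.integral_iterDeriv_mul {u φ : Euc n → ℂ} (hu : SmoothOff u) (h : IsTest φ)
    (R : List (Fin n)) :
    ∫ y, MomentumRay.iterDeriv R u y * φ y =
      (-1) ^ R.length * ∫ y, u y * MomentumRay.iterDeriv R.reverse φ y := by
  induction R generalizing φ with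
  | nil => simp
  | cons i R ih =>
    rw [iterDeriv_cons, (hu.iterDeriv R).integral_partialDeriv_mul h, ih (h.partialDeriv i),
      List.reverse_cons, iterDeriv_append, List.length_cons]
    simp only [iterDeriv_cons, iterDeriv_nil]
    ring

theorem integral_iterate_divField_mul {S : List (Fin n) → Euc n → ℂ} (hS : SymField S)
    {φ : Euc n → ℂ} (h : IsTest φ) (k : ℕ) (X : List (Fin n)) :
    ∫ y, divField^[k] S X y * φ y =
      (-1) ^ k * ∑ K : Fin k → Fin n,
        ∫ y, S (List.ofFn K ++ X) y * iterDeriv (List.ofFn K) φ y := by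
  induction k generalizing φ X with
  | zero => simp
  | succ k ih =>
    have h1 : ∫ y, divField^[k + 1] S X y * φ y =
        ∑ l, ∫ y, partialDeriv l (divField^[k] S (l :: X)) y * φ y := by
      rw [Function.iterate_succ_apply']
      simp only [divField, Finset.sum_mul]
      exact MeasureTheory.integral_finsetSum _ fun l _ => h.integrable_mul
        (((hS.iterate_divField k).smooth _).partialDeriv l).continuousOn
    rw [h1]
    simp_rw [((hS.iterate_divField k).smooth _).integral_partialDeriv_mul h,
      ih (h.partialDeriv _)]
    rw [← (Fin.snocEquiv fun _ : Fin (k + 1) => Fin n).sum_comp, Fintype.sum_prod_type,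
      Finset.mul_sum]
    refine Finset.sum_congr rfl fun l _ => ?_
    rw [pow_succ, mul_neg_one, neg_mul]
    refine congrArg (fun z : ℂ => -(_ * z)) (Finset.sum_congr rfl fun K _ => ?_)
    have : List.ofFn (Fin.snocEquiv (fun _ : Fin (k + 1) => Fin n) (l, K)) = List.ofFn K ++ [l] := by
      rw [List.ofFn_succ']
      simp [Fin.snocEquiv]
    rw [this, iterDeriv_append]
    simp [iterDeriv_cons]

/-! ### Powers of the norm -/

/-- The function `|y|^e`. -/
def normPow (e : ℤ) (y : Euc n) : ℂ := ((‖y‖ ^ e : ℝ) : ℂ)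

theorem norm_sq_eq_sum (y : Euc n) : ((‖y‖ ^ 2 : ℝ) : ℂ) = ∑ l, ((y l : ℝ) : ℂ) * ((y l : ℝ) : ℂ) := by
  rw [EuclideanSpace.real_norm_sq_eq]
  push_cast
  exact Finset.sum_congr rfl fun l _ => by ring

theorem smoothOff_normPow (e : ℤ) : SmoothOff (normPow e : Euc n → ℂ) := by
  intro y hy
  refine ContDiffAt.contDiffWithinAt ?_
  have h : ContDiffAt ℝ ∞ (fun z : Euc n => ‖z‖ ^ e) y := by
    have hn : ContDiffAt ℝ ∞ (fun z : Euc n => ‖z‖) y := contDiffAt_norm ℝ hy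
    cases e with
    | ofNat a => simpa using hn.pow a
    | negSucc a =>
      simp only [zpow_negSucc]
      exact ContDiffAt.inv (hn.pow (a + 1)) (by simpa using hy)
  exact Complex.ofRealCLM.contDiff.contDiffAt.comp y h

theorem partialDeriv_normPow (e : ℤ) (i : Fin n) {y : Euc n} (hy : y ≠ 0) :
    partialDeriv i (normPow e) y = e * (((y i : ℝ) : ℂ) * normPow (e - 2) y) := by
  have hy' : ‖y‖ ≠ 0 := norm_ne_zero_iff.2 hy
  have hsq : HasFDerivAt (fun z : Euc n => ‖z‖ ^ 2) (2 • innerSL ℝ y) y :=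
    (hasStrictFDerivAt_norm_sq y).hasFDerivAt
  have hs : HasFDerivAt (fun z : Euc n => Real.sqrt (‖z‖ ^ 2))
      ((1 / (2 * Real.sqrt (‖y‖ ^ 2))) • (2 • innerSL ℝ y)) y := hsq.sqrt (by positivity)
  simp only [Real.sqrt_sq (norm_nonneg _)] at hs
  have hz := (hasDerivAt_zpow e ‖y‖ (Or.inl hy')).comp_hasFDerivAt y hs
  have hc := Complex.ofRealCLM.hasFDerivAt.comp y hz
  have hf : (⇑Complex.ofRealCLM ∘ ((fun x : ℝ => x ^ e) ∘ fun z : Euc n => ‖z‖)) = normPow e := rfl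
  rw [hf] at hc
  rw [partialDeriv, hc.fderiv]
  have : (inner ℝ y (EuclideanSpace.single i (1 : ℝ)) : ℝ) = y i := by
    simp [EuclideanSpace.inner_single_right]
  simp only [ContinuousLinearMap.comp_apply, smul_apply, nsmul_eq_mul,
    innerSL_apply_apply, this, Complex.ofRealCLM_apply, smul_eq_mul, normPow]
  have h2 : ‖y‖ ^ (e - 1) = ‖y‖ ^ (e - 2) * ‖y‖ := by
    rw [← zpow_add_one₀ hy']; congr 1; ring
  rw [h2]
  push_cast
  have hyc : (‖y‖ : ℂ) ≠ 0 := by exact_mod_cast hy'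
  field_simp

theorem normPow_sub_two_mul (e : ℤ) {y : Euc n} (hy : y ≠ 0) :
    (∑ l, ((y l : ℝ) : ℂ) * ((y l : ℝ) : ℂ)) * normPow (e - 2) y = normPow e y := by
  rw [← norm_sq_eq_sum, normPow, normPow, ← Complex.ofReal_mul]
  congr 1
  rw [← zpow_natCast, ← zpow_add₀ (norm_ne_zero_iff.2 hy)]
  congr 1
  push_cast
  ring

theorem laplacian_normPow (e : ℤ) {y : Euc n} (hy : y ≠ 0) :
    ∑ l, partialDeriv l (partialDeriv l (normPow e)) y =
      e * (e + n - 2) * normPow (e - 2) y := by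
  have h1 : ∀ l : Fin n, partialDeriv l (partialDeriv l (normPow e)) y =
      e * ((((y l : ℝ) : ℂ) * ((y l : ℝ) : ℂ)) * normPow (e - 2 - 2) y) * (e - 2 : ℤ) +
        e * normPow (e - 2) y := by
    intro l
    have hs := smoothOff_normPow (n := n) (e - 2)
    have hc := (contDiff_coord (n := n) l).smoothOff
    rw [partialDeriv_congr (fun z hz => partialDeriv_normPow e l hz) l hy,
      partialDeriv_const_mul ((hc.mul hs).differentiableAt hy),
      partialDeriv_mul (hc.differentiableAt hy) (hs.differentiableAt hy),
      partialDeriv_normPow _ _ hy, partialDeriv_coord, if_pos rfl]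
    ring
  rw [Finset.sum_congr rfl fun l _ => h1 l, Finset.sum_add_distrib, ← Finset.sum_mul,
    ← Finset.mul_sum, ← Finset.sum_mul, normPow_sub_two_mul _ hy]
  simp
  ring

/-- Euler's identity for the derivatives of a power of the norm. -/
theorem euler_iterDeriv_normPow (e : ℤ) (R : List (Fin n)) {y : Euc n} (hy : y ≠ 0) :
    ∑ l, ((y l : ℝ) : ℂ) * iterDeriv (l :: R) (normPow e) y =
      ((e - R.length : ℤ) : ℂ) * iterDeriv R (normPow e) y := by
  induction R generalizing y with
  | nil =>
    simp only [iterDeriv_cons, iterDeriv_nil, List.length_nil]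
    rw [Finset.sum_congr rfl fun l _ => by rw [partialDeriv_normPow e l hy],
      ← normPow_sub_two_mul e hy, Finset.sum_mul, Finset.mul_sum]
    refine Finset.sum_congr rfl fun l _ => ?_
    push_cast
    ring
  | cons i R ih =>
    have hs := smoothOff_normPow (n := n) e
    have h1 := partialDeriv_congr (fun z hz => ih hz) i hy
    rw [partialDeriv_const_mul ((hs.iterDeriv R).differentiableAt hy),
      partialDeriv_sum fun l _ =>
        ((contDiff_coord l).smoothOff.mul (hs.iterDeriv (l :: R))).differentiableAt hy,
      Finset.sum_congr rfl fun l _ => partialDeriv_mul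
        ((contDiff_coord l).smoothOff.differentiableAt hy)
        ((hs.iterDeriv (l :: R)).differentiableAt hy) i, Finset.sum_add_distrib] at h1
    simp only [partialDeriv_coord, mul_ite, mul_one, mul_zero, Finset.sum_ite_eq',
      Finset.mem_univ, if_true] at h1
    have h2 : ∀ l, iterDeriv (l :: i :: R) (normPow e) y =
        partialDeriv i (iterDeriv (l :: R) (normPow e)) y := fun l =>
      iterDeriv_perm hs (List.Perm.swap i l R) hy
    simp_rw [h2]
    rw [eq_sub_of_add_eq h1, List.length_cons, iterDeriv_cons]
    push_cast
    ring

theorem trace_iterDeriv_normPow (e : ℤ) (R : List (Fin n)) {y : Euc n} (hy : y ≠ 0) :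
    ∑ l, iterDeriv (l :: l :: R) (normPow e) y =
      e * (e + n - 2) * iterDeriv R (normPow (e - 2)) y := by
  have hs := smoothOff_normPow (n := n) e
  have h1 : ∀ l, iterDeriv (l :: l :: R) (normPow e) y =
      iterDeriv R (iterDeriv [l, l] (normPow e)) y := by
    intro l
    rw [← iterDeriv_append]
    exact iterDeriv_perm hs (List.perm_append_comm (l₁ := [l, l])) hy
  rw [Finset.sum_congr rfl fun l _ => h1 l,
    ← iterDeriv_sum (fun l _ => hs.iterDeriv [l, l]) R hy,
    iterDeriv_congr (u := fun z => ∑ i, iterDeriv [i, i] (normPow e) z)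
      (v := fun z => e * (e + n - 2) * normPow (e - 2) z)
      (fun z hz => laplacian_normPow e hz) R hy,
    iterDeriv_const_mul (smoothOff_normPow _) _ R hy]

/-! ### Derivatives of radial functions -/

/-- The value of a complex polynomial at a point of `ℝⁿ`. -/
def polyEval (P : MvPolynomial (Fin n) ℂ) (y : Euc n) : ℂ :=
  MvPolynomial.eval (fun i => ((y i : ℝ) : ℂ)) P

theorem contDiff_polyEval (P : MvPolynomial (Fin n) ℂ) : ContDiff ℝ ∞ (polyEval P) := by
  induction P using MvPolynomial.induction_on with
  | C a =>
    have : polyEval (MvPolynomial.C a) = fun _ : Euc n => a := by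
      funext y; simp [polyEval]
    rw [this]; exact contDiff_const
  | add p q hp hq =>
    have : polyEval (p + q) = fun y => polyEval p y + polyEval q y := by
      funext y; simp [polyEval]
    rw [this]; exact hp.add hq
  | mul_X p i hp =>
    have : polyEval (p * MvPolynomial.X i) = fun y => polyEval p y * ((y i : ℝ) : ℂ) := by
      funext y; simp [polyEval]
    rw [this]; exact hp.mul (contDiff_coord i)

theorem partialDeriv_polyEval (P : MvPolynomial (Fin n) ℂ) (i : Fin n) (y : Euc n) :
    partialDeriv i (polyEval P) y = polyEval (MvPolynomial.pderiv i P) y := by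
  induction P using MvPolynomial.induction_on with
  | C a =>
    have : polyEval (MvPolynomial.C a) = fun _ : Euc n => a := by
      funext y; simp [polyEval]
    rw [this, partialDeriv_const]
    simp [polyEval]
  | add p q hp hq =>
    have : polyEval (p + q) = fun y => polyEval p y + polyEval q y := by
      funext y; simp [polyEval]
    rw [this, partialDeriv, fderiv_fun_add (((contDiff_polyEval p).differentiable (by simp)) y)
      (((contDiff_polyEval q).differentiable (by simp)) y)]
    change partialDeriv i (polyEval p) y + partialDeriv i (polyEval q) y = _
    rw [hp, hq]
    simp [polyEval]
  | mul_X p j hp =>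
    have : polyEval (p * MvPolynomial.X j) = fun y => polyEval p y * ((y j : ℝ) : ℂ) := by
      funext y; simp [polyEval]
    rw [this, partialDeriv_mul (((contDiff_polyEval p).differentiable (by simp)) y)
      (((contDiff_coord j).differentiable (by simp)) y), hp, partialDeriv_coord]
    by_cases hji : j = i <;> simp [polyEval, MvPolynomial.pderiv_X, hji]

/-- The coefficient of `F^{(r)}(|y|²)` in the derivative `∂_R (F(|y|²))`. -/
def radialCoeff : List (Fin n) → ℕ → MvPolynomial (Fin n) ℂ
  | [], 0 => 1
  | [], _ + 1 => 0
  | i :: R, 0 => MvPolynomial.pderiv i (radialCoeff R 0)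
  | i :: R, r + 1 => 2 * MvPolynomial.X i * radialCoeff R r +
      MvPolynomial.pderiv i (radialCoeff R (r + 1))

theorem radialCoeff_eq_zero_of_length_lt (R : List (Fin n)) {r : ℕ} (h : R.length < r) :
    radialCoeff R r = 0 := by
  induction R generalizing r with
  | nil =>
    cases r with
    | zero => simp at h
    | succ r => rfl
  | cons i R ih =>
    cases r with
    | zero => simp at h
    | succ r =>
      rw [List.length_cons] at h
      rw [radialCoeff, ih (by omega), ih (by omega)]
      simp

theorem isHomogeneous_radialCoeff (R : List (Fin n)) (r : ℕ) :
    (R.length ≤ 2 * r → (radialCoeff R r).IsHomogeneous (2 * r - R.length)) ∧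
      (2 * r < R.length → radialCoeff R r = 0) := by
  induction R generalizing r with
  | nil =>
    refine ⟨fun _ => ?_, fun h => by simp at h⟩
    cases r with
    | zero => exact MvPolynomial.isHomogeneous_one _ _
    | succ r => exact MvPolynomial.isHomogeneous_zero _ _ _
  | cons i R ih =>
    have hd : ∀ r, R.length + 1 ≤ 2 * r →
        (MvPolynomial.pderiv i (radialCoeff R r)).IsHomogeneous (2 * r - (R.length + 1)) := by
      intro r h
      have := ((ih r).1 (by omega)).pderiv (i := i)
      rwa [Nat.sub_sub] at this
    have hd0 : ∀ r, 2 * r < R.length + 1 → MvPolynomial.pderiv i (radialCoeff R r) = 0 := by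
      intro r h
      rcases Nat.lt_or_ge (2 * r) R.length with h1 | h1
      · rw [(ih r).2 h1, map_zero]
      · have h0 := (ih r).1 h1
        rw [show 2 * r - R.length = 0 by omega] at h0
        rw [MvPolynomial.totalDegree_eq_zero_iff_eq_C.1 (Nat.le_zero.1 h0.totalDegree_le),
          MvPolynomial.pderiv_C]
    rw [List.length_cons]
    cases r with
    | zero => exact ⟨fun h => by omega, fun _ => hd0 0 (by omega)⟩
    | succ r =>
      refine ⟨fun h => ?_, fun h => ?_⟩
      · refine MvPolynomial.IsHomogeneous.add ?_ (hd (r + 1) h)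
        rcases Nat.lt_or_ge (2 * r) R.length with h1 | h1
        · rw [(ih r).2 h1, mul_zero]
          exact MvPolynomial.isHomogeneous_zero _ _ _
        · have h2 : (2 * MvPolynomial.X i : MvPolynomial (Fin n) ℂ).IsHomogeneous 1 := by
            have := (MvPolynomial.isHomogeneous_C (Fin n) (2 : ℂ)).mul
              (MvPolynomial.isHomogeneous_X ℂ i)
            rwa [map_ofNat, zero_add] at this
          have := h2.mul ((ih r).1 h1)
          rwa [show 1 + (2 * r - R.length) = 2 * (r + 1) - (R.length + 1) by omega] at this
      · rw [radialCoeff, (ih r).2 (by omega), hd0 (r + 1) h]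
        simp

theorem radialCoeff_eq_zero_of_lt (R : List (Fin n)) {r : ℕ} (h : 2 * r < R.length) :
    radialCoeff R r = 0 := (isHomogeneous_radialCoeff R r).2 h

/-- The derivatives of a radial function, given the sequence `g r = F^{(r)}(|y|²)`. -/
theorem iterDeriv_radial {g : ℕ → Euc n → ℂ} (hg : ∀ r, SmoothOff (g r))
    (hd : ∀ r i, ∀ y ≠ 0, partialDeriv i (g r) y = 2 * ((y i : ℝ) : ℂ) * g (r + 1) y)
    (R : List (Fin n)) {y : Euc n} (hy : y ≠ 0) :
    iterDeriv R (g 0) y =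
      ∑ r ∈ Finset.range (R.length + 1), polyEval (radialCoeff R r) y * g r y := by
  induction R generalizing y with
  | nil => simp [radialCoeff, polyEval]
  | cons i R ih =>
    have hs := fun r => (contDiff_polyEval (radialCoeff R r)).smoothOff
    rw [iterDeriv_cons, partialDeriv_congr (fun z hz => ih hz) i hy,
      partialDeriv_sum fun r _ => ((hs r).mul (hg r)).differentiableAt hy,
      Finset.sum_congr rfl fun r _ => partialDeriv_mul ((hs r).differentiableAt hy)
        ((hg r).differentiableAt hy) i, Finset.sum_add_distrib, List.length_cons,
      Finset.sum_range_succ' _ (R.length + 1)]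
    have h1 : ∀ r, polyEval (radialCoeff (i :: R) (r + 1)) y =
        2 * ((y i : ℝ) : ℂ) * polyEval (radialCoeff R r) y +
          polyEval (MvPolynomial.pderiv i (radialCoeff R (r + 1))) y := by
      intro r; simp [radialCoeff, polyEval]
    have h2 : ∑ r ∈ Finset.range (R.length + 1),
          polyEval (MvPolynomial.pderiv i (radialCoeff R r)) y * g r y =
        ∑ r ∈ Finset.range (R.length + 1),
          polyEval (MvPolynomial.pderiv i (radialCoeff R (r + 1))) y * g (r + 1) y +
        polyEval (MvPolynomial.pderiv i (radialCoeff R 0)) y * g 0 y := by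
      rw [← Finset.sum_range_succ' (fun r =>
        polyEval (MvPolynomial.pderiv i (radialCoeff R r)) y * g r y),
        Finset.sum_range_succ _ (R.length + 1),
        radialCoeff_eq_zero_of_length_lt R (Nat.lt_succ_self _)]
      simp [polyEval]
    simp_rw [h1, add_mul, partialDeriv_polyEval, mul_comm (g _ y), hd _ i y hy]
    rw [h2, Finset.sum_add_distrib, ← add_assoc]
    refine congrArg₂ _ (congrArg₂ _ (Finset.sum_congr rfl fun r _ => by ring) rfl) rfl

theorem iterDeriv_gaussian (μ : ℝ) (R : List (Fin n)) {y : Euc n} (hy : y ≠ 0) :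
    iterDeriv R (fun z => ((Real.exp (-μ * ‖z‖ ^ 2) : ℝ) : ℂ)) y =
      ∑ r ∈ Finset.range (R.length + 1), polyEval (radialCoeff R r) y *
        ((-μ : ℂ) ^ r * ((Real.exp (-μ * ‖y‖ ^ 2) : ℝ) : ℂ)) := by
  have hsm : ContDiff ℝ ∞ (fun z : Euc n => ((Real.exp (-μ * ‖z‖ ^ 2) : ℝ) : ℂ)) :=
    Complex.ofRealCLM.contDiff.comp
      (Real.contDiff_exp.comp (contDiff_const.mul (contDiff_norm_sq ℝ)))
  have := iterDeriv_radial
    (g := fun r z => (-μ : ℂ) ^ r * ((Real.exp (-μ * ‖z‖ ^ 2) : ℝ) : ℂ))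
    (fun r => (smoothOff_const _).mul hsm.smoothOff) ?_ R hy
  · simpa using this
  intro r i z hz
  rw [partialDeriv_const_mul ((hsm.differentiable (by simp)) z)]
  have h1 : HasFDerivAt (fun z : Euc n => Real.exp (-μ * ‖z‖ ^ 2))
      (Real.exp (-μ * ‖z‖ ^ 2) • ((-μ) • (2 • innerSL ℝ z))) z :=
    (((hasStrictFDerivAt_norm_sq z).hasFDerivAt).const_mul (-μ)).exp
  have h2 := Complex.ofRealCLM.hasFDerivAt.comp z h1
  have h3 : partialDeriv i (fun z : Euc n => ((Real.exp (-μ * ‖z‖ ^ 2) : ℝ) : ℂ)) z =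
      ((Real.exp (-μ * ‖z‖ ^ 2) * (-μ * (2 * z i)) : ℝ) : ℂ) := by
    rw [partialDeriv]
    refine (congrArg (fun A => A (EuclideanSpace.single i (1 : ℝ))) h2.fderiv).trans ?_
    simp [EuclideanSpace.inner_single_right]
  rw [h3]
  push_cast
  ring

/-- The value at `1` of the `r`-th derivative of `a ↦ a^{p - 1/2}`. -/
def halfDesc (p r : ℕ) : ℝ := ∏ j ∈ Finset.range r, ((p : ℝ) - 1 / 2 - j)

theorem halfDesc_eq (p t : ℕ) :
    halfDesc p (p + t) = (Nat.doubleFactorial (2 * p - 1) : ℝ) / 2 ^ p *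
      ((-1) ^ t * Real.Gamma (t + 1 / 2) / Real.sqrt Real.pi) := by
  have hpi : Real.sqrt Real.pi ≠ 0 := (Real.sqrt_pos.2 Real.pi_pos).ne'
  induction t with
  | zero =>
    have h1 : ∀ p : ℕ, halfDesc p p * Real.sqrt Real.pi = Real.Gamma (p + 1 / 2) := by
      intro p
      induction p with
      | zero => simp [halfDesc, -one_div, Real.Gamma_one_half_eq]
      | succ p ih =>
        have h2 : halfDesc (p + 1) (p + 1) = (p + 1 / 2) * halfDesc p p := by
          rw [halfDesc, Finset.prod_range_succ', mul_comm, halfDesc]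
          congr 1
          · push_cast; ring
          · refine Finset.prod_congr rfl fun j _ => ?_
            push_cast; ring
        rw [h2, mul_assoc, ih, Nat.cast_add_one, add_right_comm,
          Real.Gamma_add_one (by positivity)]
    have h2 := h1 p
    rw [Real.Gamma_nat_add_half] at h2
    have h3 := mul_right_cancel₀ hpi (h2.trans (div_mul_eq_mul_div _ _ _).symm)
    rw [add_zero, h3]
    simp [-one_div, Real.Gamma_one_half_eq, hpi]
  | succ t ih =>
    rw [← add_assoc, halfDesc, Finset.prod_range_succ]
    change halfDesc p (p + t) * _ = _
    rw [ih, Nat.cast_add_one, add_right_comm, Real.Gamma_add_one (by positivity)]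
    push_cast
    ring

theorem iterDeriv_normPow (p : ℕ) (R : List (Fin n)) {y : Euc n} (hy : y ≠ 0) :
    iterDeriv R (normPow (2 * p - 1)) y =
      ∑ r ∈ Finset.range (R.length + 1), polyEval (radialCoeff R r) y *
        ((halfDesc p r : ℂ) * normPow (2 * p - 1 - 2 * r) y) := by
  have := iterDeriv_radial
    (g := fun r z => (halfDesc p r : ℂ) * normPow (2 * p - 1 - 2 * r) z)
    (fun r => (smoothOff_const _).mul (smoothOff_normPow _)) ?_ R hy
  · simpa [halfDesc] using this
  intro r i z hz
  rw [partialDeriv_const_mul ((smoothOff_normPow _).differentiableAt hz),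
    partialDeriv_normPow _ _ hz, halfDesc, halfDesc, Finset.prod_range_succ,
    show (2 * (p : ℤ) - 1 - 2 * ((r + 1 : ℕ) : ℤ)) = 2 * p - 1 - 2 * r - 2 by push_cast; ring]
  push_cast
  ring

/-! ### The homogeneous kernel and polar coordinates -/

/-- The monomial `x_{i₁} ⋯ x_{i_r}`. -/
def mono (R : List (Fin n)) (x : Euc n) : ℂ := (R.map fun i => ((x i : ℝ) : ℂ)).prod

@[simp] theorem mono_nil (x : Euc n) : mono [] x = 1 := rfl

theorem mono_cons (i : Fin n) (R : List (Fin n)) (x : Euc n) :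
    mono (i :: R) x = ((x i : ℝ) : ℂ) * mono R x := by simp [mono]

theorem mono_append (R R' : List (Fin n)) (x : Euc n) :
    mono (R ++ R') x = mono R x * mono R' x := by simp [mono]

theorem mono_ofFn {k : ℕ} (i : Fin k → Fin n) (x : Euc n) :
    mono (List.ofFn i) x = ∏ a, ((x (i a) : ℝ) : ℂ) := by
  simp [mono, List.map_ofFn, List.prod_ofFn, Function.comp_def]

theorem mono_smul (R : List (Fin n)) (r : ℝ) (x : Euc n) :
    mono R (r • x) = (r : ℂ) ^ R.length * mono R x := by
  induction R with
  | nil => simp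
  | cons i R ih =>
    rw [mono_cons, mono_cons, ih, List.length_cons]
    simp only [PiLp.smul_apply, smul_eq_mul, Complex.ofReal_mul]
    ring

theorem contDiff_mono (R : List (Fin n)) : ContDiff ℝ ∞ (mono R) := by
  induction R with
  | nil => exact contDiff_const
  | cons i R ih =>
    have : mono (i :: R) = fun x => ((x i : ℝ) : ℂ) * mono R x := funext (mono_cons i R)
    rw [this]; exact (contDiff_coord i).mul ih

theorem norm_mono_le (R : List (Fin n)) (x : Euc n) : ‖mono R x‖ ≤ ‖x‖ ^ R.length := by
  induction R with
  | nil => simp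
  | cons i R ih =>
    rw [mono_cons, norm_mul, List.length_cons, pow_succ', Complex.norm_real]
    exact mul_le_mul (PiLp.norm_apply_le x i) ih (norm_nonneg _) (norm_nonneg _)

/-- The kernel `w_R |w|^{-|R|-n+1}`, homogeneous of degree `1 - n`. -/
def rayKernel (R : List (Fin n)) (w : Euc n) : ℂ :=
  mono R w * normPow (-(R.length : ℤ) - n + 1) w

theorem measurable_normPow (e : ℤ) : Measurable (normPow e : Euc n → ℂ) :=
  Complex.measurable_ofReal.comp (measurable_norm.pow_const e)

theorem measurable_rayKernel (R : List (Fin n)) : Measurable (rayKernel R) :=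
  (contDiff_mono R).continuous.measurable.mul (measurable_normPow _)

theorem norm_rayKernel_le (hn : 2 ≤ n) (R : List (Fin n)) (w : Euc n) :
    ‖rayKernel R w‖ ≤ (‖w‖ ^ (n - 1))⁻¹ := by
  rw [rayKernel, norm_mul, normPow, Complex.norm_real, norm_zpow, norm_norm]
  rcases eq_or_ne w 0 with rfl | hw
  · rw [norm_zero, zero_zpow _ (by omega), mul_zero]
    positivity
  · have hw' : 0 < ‖w‖ := norm_pos_iff.2 hw
    calc ‖mono R w‖ * ‖w‖ ^ (-(R.length : ℤ) - n + 1)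
        ≤ ‖w‖ ^ R.length * ‖w‖ ^ (-(R.length : ℤ) - n + 1) := by
          gcongr; exact norm_mono_le R w
      _ = (‖w‖ ^ (n - 1))⁻¹ := by
          rw [← zpow_natCast, ← zpow_add₀ hw'.ne', ← zpow_natCast, ← zpow_neg]
          congr 1
          push_cast [Nat.cast_sub (show 1 ≤ n by omega)]
          ring

theorem rayKernel_smul (hn : 2 ≤ n) (R : List (Fin n)) {r : ℝ} (hr : 0 < r)
    {w : Euc n} (hw : ‖w‖ = 1) :
    ((r ^ (n - 1) : ℝ) : ℂ) * rayKernel R (r • w) = mono R w := by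
  have h1 : normPow (-(R.length : ℤ) - n + 1) (r • w) =
      ((r ^ (-(R.length : ℤ) - n + 1) : ℝ) : ℂ) := by
    rw [normPow, norm_smul, hw, mul_one, Real.norm_of_nonneg hr.le]
  rw [rayKernel, mono_smul, h1]
  have h2 : r ^ (n - 1) * r ^ R.length * r ^ (-(R.length : ℤ) - n + 1) = 1 := by
    rw [← zpow_natCast, ← zpow_natCast r R.length, ← zpow_add₀ hr.ne', ← zpow_add₀ hr.ne',
      show ((n - 1 : ℕ) : ℤ) + R.length + (-(R.length : ℤ) - n + 1) = 0 by
        push_cast [Nat.cast_sub (show 1 ≤ n by omega)]; ring, zpow_zero]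
  calc _ = ((r ^ (n - 1) * r ^ R.length * r ^ (-(R.length : ℤ) - n + 1) : ℝ) : ℂ) * mono R w := by
        push_cast; ring
    _ = mono R w := by rw [h2]; simp

theorem rayKernel_neg {R : List (Fin n)} (hR : Even R.length) (w : Euc n) :
    rayKernel R (-w) = rayKernel R w := by
  have h := mono_smul R (-1) w
  rw [neg_one_smul] at h
  rw [rayKernel, rayKernel, h, normPow, normPow, norm_neg]
  push_cast
  rw [hR.neg_one_pow, one_mul]

theorem integrable_inv_one_add_sq :
    MeasureTheory.Integrable (fun s : ℝ => ((1 + ‖s‖) ^ 2)⁻¹) := by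
  have := integrable_one_add_norm (E := ℝ) (μ := MeasureTheory.volume) (r := 2) (by simp)
  refine this.congr (Filter.Eventually.of_forall fun s => ?_)
  beta_reduce
  rw [Real.rpow_neg (by positivity), Real.rpow_two]

/-- The weight `|w|^{1-n} (1 + |w|)^{-2}`. -/
def weight (w : Euc n) : ℝ := (‖w‖ ^ (n - 1))⁻¹ * ((1 + ‖w‖) ^ 2)⁻¹

theorem nontrivial_euc (hn : 2 ≤ n) : Nontrivial (Euc n) :=
  Module.nontrivial_of_finrank_pos (R := ℝ) (by simp; omega)

theorem integrable_weight (hn : 2 ≤ n) : MeasureTheory.Integrable (weight : Euc n → ℝ) := by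
  have := nontrivial_euc hn
  have := (MeasureTheory.integrable_fun_norm_addHaar (E := Euc n) MeasureTheory.volume
    (f := fun r => (r ^ (n - 1))⁻¹ * ((1 + r) ^ 2)⁻¹)).2
  refine this ?_
  refine (integrable_inv_one_add_sq.integrableOn (s := Set.Ioi 0)).congr_fun ?_ measurableSet_Ioi
  intro r hr
  have hr' : 0 < r := hr
  simp only [finrank_euclideanSpace, Fintype.card_fin, smul_eq_mul]
  rw [← mul_assoc, mul_inv_cancel₀ (by positivity), one_mul, Real.norm_of_nonneg hr'.le]

theorem integrable_rayKernel_mul (hn : 2 ≤ n) (R : List (Fin n)) {h : Euc n → ℂ}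
    (hm : Measurable h) {C : ℝ} (hC : ∀ w, ‖h w‖ ≤ C * ((1 + ‖w‖) ^ 2)⁻¹) :
    MeasureTheory.Integrable (fun w => rayKernel R w * h w) := by
  refine ((integrable_weight hn).const_mul C).mono'
    ((measurable_rayKernel R).mul hm).aestronglyMeasurable
    (Filter.Eventually.of_forall fun w => ?_)
  rw [norm_mul, weight]
  calc ‖rayKernel R w‖ * ‖h w‖ ≤ (‖w‖ ^ (n - 1))⁻¹ * (C * ((1 + ‖w‖) ^ 2)⁻¹) := by
        gcongr
        · exact norm_rayKernel_le hn R w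
        · exact hC w
    _ = _ := by ring

theorem polar_coordinates (hn : 2 ≤ n) {f : Euc n → ℂ} (hf : MeasureTheory.Integrable f) :
    MeasureTheory.Integrable (fun ξ : Metric.sphere (0 : Euc n) 1 =>
        ∫ r in Set.Ioi (0 : ℝ), ((r ^ (n - 1) : ℝ) : ℂ) * f (r • (ξ : Euc n)))
      (MeasureTheory.volume : MeasureTheory.Measure (Euc n)).toSphere ∧
    ∫ w, f w = ∫ ξ : Metric.sphere (0 : Euc n) 1,
        (∫ r in Set.Ioi (0 : ℝ), ((r ^ (n - 1) : ℝ) : ℂ) * f (r • (ξ : Euc n)))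
      ∂(MeasureTheory.volume : MeasureTheory.Measure (Euc n)).toSphere := by
  have := nontrivial_euc hn
  set μ : MeasureTheory.Measure (Euc n) := MeasureTheory.volume
  have hmp := μ.measurePreserving_homeomorphUnitSphereProd
  have hemb := (homeomorphUnitSphereProd (Euc n)).measurableEmbedding
  set g : Metric.sphere (0 : Euc n) 1 × Set.Ioi (0 : ℝ) → ℂ := fun q => f (q.2.1 • (q.1 : Euc n))
  have hg : ∀ x : ({0}ᶜ : Set (Euc n)), g (homeomorphUnitSphereProd (Euc n) x) = f x := by
    intro x
    have h1 := congrArg Subtype.val ((homeomorphUnitSphereProd (Euc n)).symm_apply_apply x)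
    rw [homeomorphUnitSphereProd_symm_apply_coe] at h1
    exact congrArg f h1
  have hint : MeasureTheory.Integrable g
      (μ.toSphere.prod (MeasureTheory.Measure.volumeIoiPow (Module.finrank ℝ (Euc n) - 1))) := by
    rw [← hmp.integrable_comp_emb hemb]
    have : g ∘ homeomorphUnitSphereProd (Euc n) = fun x : ({0}ᶜ : Set (Euc n)) => f x := funext hg
    rw [this]
    rw [← MeasureTheory.restrict_compl_singleton (μ := μ) 0, ← MeasureTheory.IntegrableOn,
      MeasureTheory.integrableOn_iff_comap_subtypeVal (by measurability)] at hf
    exact hf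
  have hinner : ∀ ξ : Metric.sphere (0 : Euc n) 1,
      ∫ r, g (ξ, r) ∂(MeasureTheory.Measure.volumeIoiPow (Module.finrank ℝ (Euc n) - 1)) =
        ∫ r in Set.Ioi (0 : ℝ), ((r ^ (n - 1) : ℝ) : ℂ) * f (r • (ξ : Euc n)) := by
    intro ξ
    simp only [MeasureTheory.Measure.volumeIoiPow, ENNReal.ofReal]
    rw [integral_withDensity_eq_integral_smul]
    · refine (MeasureTheory.integral_subtype_comap measurableSet_Ioi fun a : ℝ =>
        Real.toNNReal (a ^ (Module.finrank ℝ (Euc n) - 1)) • f (a • (ξ : Euc n))).trans ?_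
      refine MeasureTheory.setIntegral_congr_fun measurableSet_Ioi fun r hr => ?_
      have hr' : 0 < r := hr
      simp only [finrank_euclideanSpace, Fintype.card_fin]
      rw [NNReal.smul_def, Real.coe_toNNReal _ (by positivity), Complex.real_smul]
    · exact (measurable_subtype_coe.pow_const _).real_toNNReal
  have h1 := hint.integral_prod_left
  have h2 := MeasureTheory.integral_prod g hint
  simp only [hinner] at h1 h2
  refine ⟨h1, ?_⟩
  rw [← h2, ← hmp.integral_comp hemb]
  simp only [hg]
  rw [MeasureTheory.integral_subtype_comap (measurableSet_singleton _).compl fun x => f x,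
    MeasureTheory.restrict_compl_singleton]

/-- Polar coordinates for integration against the homogeneous kernel over both half-lines. -/
theorem integral_sphere_line (hn : 2 ≤ n) {R : List (Fin n)} (hR : Even R.length) {h : Euc n → ℂ}
    (hm : Continuous h) {C : ℝ} (hC : ∀ w, ‖h w‖ ≤ C * ((1 + ‖w‖) ^ 2)⁻¹) :
    MeasureTheory.Integrable (fun ξ : Metric.sphere (0 : Euc n) 1 =>
        mono R (ξ : Euc n) * ∫ s : ℝ, h (s • (ξ : Euc n)))
      (MeasureTheory.volume : MeasureTheory.Measure (Euc n)).toSphere ∧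
    ∫ ξ : Metric.sphere (0 : Euc n) 1, mono R (ξ : Euc n) * (∫ s : ℝ, h (s • (ξ : Euc n)))
      ∂(MeasureTheory.volume : MeasureTheory.Measure (Euc n)).toSphere =
        2 * ∫ w, rayKernel R w * h w := by
  have hline : ∀ ξ : Metric.sphere (0 : Euc n) 1,
      MeasureTheory.Integrable (fun s : ℝ => h (s • (ξ : Euc n))) := by
    intro ξ
    refine (integrable_inv_one_add_sq.const_mul C).mono'
      (hm.comp (by fun_prop)).aestronglyMeasurable (Filter.Eventually.of_forall fun s => ?_)
    have := hC (s • (ξ : Euc n))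
    rwa [norm_smul, norm_eq_of_mem_sphere ξ, mul_one] at this
  have hhalf : ∀ g : Euc n → ℂ, ∀ ξ : Metric.sphere (0 : Euc n) 1,
      ∫ r in Set.Ioi (0 : ℝ), ((r ^ (n - 1) : ℝ) : ℂ) *
        (rayKernel R (r • (ξ : Euc n)) * g (r • (ξ : Euc n))) =
      mono R (ξ : Euc n) * ∫ r in Set.Ioi (0 : ℝ), g (r • (ξ : Euc n)) := by
    intro g ξ
    rw [← MeasureTheory.integral_const_mul]
    refine MeasureTheory.setIntegral_congr_fun measurableSet_Ioi fun r hr => ?_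
    beta_reduce
    rw [← mul_assoc, rayKernel_smul hn R hr (norm_eq_of_mem_sphere ξ)]
  have hsplit : ∀ ξ : Metric.sphere (0 : Euc n) 1,
      mono R (ξ : Euc n) * ∫ s : ℝ, h (s • (ξ : Euc n)) =
        mono R (ξ : Euc n) * (∫ r in Set.Ioi (0 : ℝ), h (r • (ξ : Euc n))) +
        mono R (ξ : Euc n) * ∫ r in Set.Ioi (0 : ℝ), h (-(r • (ξ : Euc n))) := by
    intro ξ
    rw [← mul_add, ← MeasureTheory.integral_add_compl measurableSet_Ioi (hline ξ),
      Set.compl_Ioi]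
    have := integral_comp_neg_Ioi (0 : ℝ) (fun s : ℝ => h (s • (ξ : Euc n)))
    simp only [neg_smul, neg_zero] at this
    rw [this]
  have h1 := polar_coordinates hn (integrable_rayKernel_mul hn R hm.measurable hC)
  have h2 := polar_coordinates hn (integrable_rayKernel_mul hn R (h := fun w => h (-w))
    (hm.comp continuous_neg).measurable (C := C) (fun w => by simpa using hC (-w)))
  simp only [hhalf] at h1
  rw [funext (hhalf fun w => h (-w))] at h2
  have h3 : ∫ w, rayKernel R w * h (-w) = ∫ w, rayKernel R w * h w := by
    rw [← MeasureTheory.integral_neg_eq_self (fun w => rayKernel R w * h (-w))]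
    simp only [rayKernel_neg hR, neg_neg]
  simp only [hsplit]
  refine ⟨h1.1.add h2.1, ?_⟩
  rw [MeasureTheory.integral_add h1.1 h2.1, ← h1.2, ← h2.2, h3, two_mul]

/-! ### Schwartz functions and their Fourier transforms -/

theorem exists_decay (h : 𝓢(Euc n, ℂ)) :
    ∃ C : ℝ, 0 ≤ C ∧ ∀ z, ‖h z‖ ≤ C * ((1 + ‖z‖) ^ 2)⁻¹ := by
  refine ⟨2 ^ 2 * (Finset.Iic (2, 0)).sup (fun m => SchwartzMap.seminorm ℂ m.1 m.2) h,
    by positivity, fun z => ?_⟩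
  have := SchwartzMap.one_add_le_sup_seminorm_apply (𝕜 := ℂ) (m := (2, 0)) (k := 2) (n := 0)
    le_rfl le_rfl h z
  rw [norm_iteratedFDeriv_zero] at this
  rw [← div_eq_mul_inv, le_div_iff₀ (by positivity), mul_comm]
  exact this

theorem inv_one_add_sq_le {E : Type*} [SeminormedAddCommGroup E] (x w : E) :
    ((1 + ‖x + w‖) ^ 2)⁻¹ ≤ (1 + ‖x‖) ^ 2 * ((1 + ‖w‖) ^ 2)⁻¹ := by
  rw [← div_eq_mul_inv, le_div_iff₀ (by positivity), inv_mul_le_iff₀ (by positivity), ← mul_pow]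
  refine pow_le_pow_left₀ (by positivity) ?_ 2
  have : ‖w‖ ≤ ‖x + w‖ + ‖x‖ := by
    calc ‖w‖ = ‖(x + w) - x‖ := by rw [add_sub_cancel_left]
      _ ≤ _ := norm_sub_le _ _
  nlinarith [norm_nonneg x, norm_nonneg (x + w)]

theorem exists_decay_shift (h : 𝓢(Euc n, ℂ)) :
    ∃ C : ℝ, 0 ≤ C ∧ ∀ x w, ‖h (x + w)‖ ≤ C * (1 + ‖x‖) ^ 2 * ((1 + ‖w‖) ^ 2)⁻¹ := by
  obtain ⟨C, hC, h1⟩ := exists_decay h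
  refine ⟨C, hC, fun x w => (h1 _).trans ?_⟩
  rw [mul_assoc]
  exact mul_le_mul_of_nonneg_left (inv_one_add_sq_le x w) hC

/-- The iterated partial derivative of a Schwartz function. -/
def schwartzDeriv : List (Fin n) → 𝓢(Euc n, ℂ) → 𝓢(Euc n, ℂ)
  | [], u => u
  | i :: R, u => ∂_{(EuclideanSpace.single i (1 : ℝ) : Euc n)} (schwartzDeriv R u)

theorem coe_schwartzDeriv (R : List (Fin n)) (u : 𝓢(Euc n, ℂ)) :
    ⇑(schwartzDeriv R u) = iterDeriv R u := by
  induction R with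
  | nil => rfl
  | cons i R ih =>
    rw [iterDeriv_cons, ← ih]
    rfl

/-- The product of a Schwartz function with the coordinate `x_j`. -/
def schwartzCoord (j : Fin n) (u : 𝓢(Euc n, ℂ)) : 𝓢(Euc n, ℂ) :=
  SchwartzMap.smulLeftCLM ℂ (inner ℝ · (EuclideanSpace.single j (1 : ℝ) : Euc n)) u

theorem schwartzCoord_apply (j : Fin n) (u : 𝓢(Euc n, ℂ)) (x : Euc n) :
    schwartzCoord j u x = ((x j : ℝ) : ℂ) * u x := by
  rw [schwartzCoord, SchwartzMap.smulLeftCLM_apply_apply (by fun_prop)]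
  simp [EuclideanSpace.inner_single_right]

/-- The product of a Schwartz function with a monomial. -/
def schwartzMono : List (Fin n) → 𝓢(Euc n, ℂ) → 𝓢(Euc n, ℂ)
  | [], u => u
  | i :: R, u => schwartzCoord i (schwartzMono R u)

theorem schwartzMono_apply (R : List (Fin n)) (u : 𝓢(Euc n, ℂ)) (x : Euc n) :
    schwartzMono R u x = mono R x * u x := by
  induction R with
  | nil => simp [schwartzMono]
  | cons i R ih => rw [schwartzMono, schwartzCoord_apply, ih, mono_cons, mul_assoc]

theorem fourier_eq_dilation (u : 𝓢(Euc n, ℂ)) (y : Euc n) :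
    fourier n u y = (((2 * Real.pi) ^ (-(n : ℝ) / 2) : ℝ) : ℂ) *
      (𝓕 u) ((2 * Real.pi)⁻¹ • y) := rfl

theorem coord_mul_fourier (j : Fin n) (u : 𝓢(Euc n, ℂ)) (w : Euc n) :
    ((w j : ℝ) : ℂ) * fourier n u w =
      -Complex.I * fourier n (∂_{(EuclideanSpace.single j (1 : ℝ) : Euc n)} u) w := by
  rw [fourier_eq_dilation, fourier_eq_dilation, SchwartzMap.fourier_lineDerivOp_eq,
    smul_apply, SchwartzMap.smulLeftCLM_apply_apply (by fun_prop),
    real_inner_smul_left, EuclideanSpace.inner_single_right]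
  have hpi : (Real.pi : ℂ) ≠ 0 := by exact_mod_cast Real.pi_ne_zero
  simp only [smul_eq_mul, Complex.real_smul, one_mul, conj_trivial]
  push_cast
  field_simp
  rw [Complex.I_sq]
  ring

theorem partialDeriv_fourier (j : Fin n) (u : 𝓢(Euc n, ℂ)) (y : Euc n) :
    partialDeriv j (fourier n u) y = -Complex.I * fourier n (schwartzCoord j u) y := by
  have hd : HasFDerivAt (fun z : Euc n => (𝓕 u) ((2 * Real.pi)⁻¹ • z))
      ((fderiv ℝ (𝓕 u : 𝓢(Euc n, ℂ)) ((2 * Real.pi)⁻¹ • y)).comp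
        ((2 * Real.pi)⁻¹ • ContinuousLinearMap.id ℝ (Euc n))) y :=
    ((𝓕 u : 𝓢(Euc n, ℂ)).hasFDerivAt _).comp y
      (((2 * Real.pi)⁻¹ • ContinuousLinearMap.id ℝ (Euc n)).hasFDerivAt)
  have h1 : partialDeriv j (fourier n u) y = (((2 * Real.pi) ^ (-(n : ℝ) / 2) : ℝ) : ℂ) *
      ((((2 * Real.pi)⁻¹ : ℝ) : ℂ) *
        (∂_{(EuclideanSpace.single j (1 : ℝ) : Euc n)} (𝓕 u)) ((2 * Real.pi)⁻¹ • y)) := by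
    have h2 : ⇑(fourier n u) = fun z => (((2 * Real.pi) ^ (-(n : ℝ) / 2) : ℝ) : ℂ) *
        (𝓕 u) ((2 * Real.pi)⁻¹ • z) := funext (fourier_eq_dilation u)
    rw [h2, partialDeriv_const_mul hd.differentiableAt, partialDeriv, hd.fderiv,
      SchwartzMap.lineDerivOp_apply_eq_fderiv]
    simp
  have h3 : 𝓕 (-(2 * Real.pi * Complex.I) • schwartzCoord j u) =
      -(2 * Real.pi * Complex.I) • 𝓕 (schwartzCoord j u) := FourierTransform.fourier_smul _ _
  rw [h1, SchwartzMap.lineDerivOp_fourier_eq, ← schwartzCoord, h3, fourier_eq_dilation,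
    smul_apply, smul_eq_mul]
  have hpi : (Real.pi : ℂ) ≠ 0 := by exact_mod_cast Real.pi_ne_zero
  push_cast
  field_simp

theorem mono_mul_fourier (R : List (Fin n)) (u : 𝓢(Euc n, ℂ)) (w : Euc n) :
    mono R w * fourier n u w = (-Complex.I) ^ R.length * fourier n (schwartzDeriv R u) w := by
  induction R with
  | nil => simp [schwartzDeriv]
  | cons i R ih =>
    rw [mono_cons, mul_assoc, ih, List.length_cons, schwartzDeriv, pow_succ, mul_assoc,
      ← coord_mul_fourier]
    ring

theorem iterDeriv_fourier (R : List (Fin n)) (u : 𝓢(Euc n, ℂ)) :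
    iterDeriv R (fourier n u) =
      fun y => (-Complex.I) ^ R.length * fourier n (schwartzMono R u) y := by
  induction R with
  | nil => simp [schwartzMono]
  | cons i R ih =>
    funext y
    rw [iterDeriv_cons, ih, partialDeriv_const_mul (SchwartzMap.differentiableAt _),
      partialDeriv_fourier, List.length_cons, schwartzMono]
    ring

theorem fourier_schwartzMono (R : List (Fin n)) (u : 𝓢(Euc n, ℂ)) (y : Euc n) :
    fourier n (schwartzMono R u) y = Complex.I ^ R.length * iterDeriv R (fourier n u) y := by
  rw [iterDeriv_fourier, ← mul_assoc, ← mul_pow]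
  simp

/-- The Fourier transform of a function. -/
def fourierFun (g : Euc n → ℂ) (y : Euc n) : ℂ :=
  (((2 * Real.pi) ^ (-(n : ℝ) / 2) : ℝ) : ℂ) *
    ∫ x : Euc n, Complex.exp (-Complex.I * ((inner ℝ y x : ℝ) : ℂ)) * g x

theorem fourierFun_coe (u : 𝓢(Euc n, ℂ)) : fourierFun u = fourier n u :=
  funext fun y => (fourier_apply u y).symm

theorem norm_exp_neg_I_mul (t : ℝ) : ‖Complex.exp (-Complex.I * (t : ℂ))‖ = 1 := by
  rw [show -Complex.I * (t : ℂ) = ((-t : ℝ) : ℂ) * Complex.I by push_cast; ring,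
    Complex.norm_exp_ofReal_mul_I]

theorem integral_mul_fourierFun {g u : Euc n → ℂ} (hg : MeasureTheory.Integrable g)
    (hu : MeasureTheory.Integrable u) :
    ∫ w, g w * fourierFun u w = ∫ y, fourierFun g y * u y := by
  have hint : MeasureTheory.Integrable (fun q : Euc n × Euc n =>
      Complex.exp (-Complex.I * ((inner ℝ q.1 q.2 : ℝ) : ℂ)) * (g q.1 * u q.2))
      (MeasureTheory.volume.prod MeasureTheory.volume) := by
    refine (hg.mul_prod hu).bdd_mul (c := 1) (Continuous.aestronglyMeasurable (by fun_prop))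
      (Filter.Eventually.of_forall fun q => (norm_exp_neg_I_mul _).le)
  have h1 := MeasureTheory.integral_integral_swap (f := fun w y =>
    Complex.exp (-Complex.I * ((inner ℝ w y : ℝ) : ℂ)) * (g w * u y)) hint
  simp only [fourierFun]
  calc _ = (((2 * Real.pi) ^ (-(n : ℝ) / 2) : ℝ) : ℂ) * ∫ w, ∫ y,
        Complex.exp (-Complex.I * ((inner ℝ w y : ℝ) : ℂ)) * (g w * u y) := by
        rw [← MeasureTheory.integral_const_mul]
        refine MeasureTheory.integral_congr_ae (Filter.Eventually.of_forall fun w => ?_)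
        beta_reduce
        rw [mul_left_comm, ← MeasureTheory.integral_const_mul]
        simp only [mul_left_comm (g w)]
    _ = (((2 * Real.pi) ^ (-(n : ℝ) / 2) : ℝ) : ℂ) * ∫ y, ∫ w,
        Complex.exp (-Complex.I * ((inner ℝ w y : ℝ) : ℂ)) * (g w * u y) := by rw [h1]
    _ = _ := by
        rw [← MeasureTheory.integral_const_mul]
        refine MeasureTheory.integral_congr_ae (Filter.Eventually.of_forall fun y => ?_)
        beta_reduce
        rw [mul_assoc, ← MeasureTheory.integral_mul_const]
        simp only [real_inner_comm, mul_assoc]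

theorem integrable_gaussian {t : ℝ} (ht : 0 < t) :
    MeasureTheory.Integrable (fun w : Euc n => ((Real.exp (-t * ‖w‖ ^ 2) : ℝ) : ℂ)) := by
  have := GaussianFourier.integrable_cexp_neg_mul_sq_norm_add (V := Euc n) (b := (t : ℂ))
    (by simpa using ht) 0 0
  refine this.congr (Filter.Eventually.of_forall fun w => ?_)
  simp

theorem fourierFun_gaussian {t : ℝ} (ht : 0 < t) (y : Euc n) :
    fourierFun (fun w : Euc n => ((Real.exp (-t * ‖w‖ ^ 2) : ℝ) : ℂ)) y =
      (((2 * t) ^ (-(n : ℝ) / 2) * Real.exp (-(4 * t)⁻¹ * ‖y‖ ^ 2) : ℝ) : ℂ) := by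
  have h1 := GaussianFourier.integral_cexp_neg_mul_sq_norm_add (V := Euc n) (b := (t : ℂ))
    (by simpa using ht) (-Complex.I) y
  have h2 : ∫ x : Euc n, Complex.exp (-Complex.I * ((inner ℝ y x : ℝ) : ℂ)) *
      ((Real.exp (-t * ‖x‖ ^ 2) : ℝ) : ℂ) =
      (((Real.pi / t) ^ ((n : ℝ) / 2) * Real.exp (-(4 * t)⁻¹ * ‖y‖ ^ 2) : ℝ) : ℂ) := by
    refine Eq.trans (MeasureTheory.integral_congr_ae (Filter.Eventually.of_forall fun x => ?_))
      (h1.trans ?_)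
    · beta_reduce
      push_cast
      rw [← Complex.exp_add, add_comm]
    · rw [finrank_euclideanSpace, Fintype.card_fin]
      push_cast
      rw [Complex.ofReal_cpow (by positivity)]
      push_cast
      congr 2
      rw [neg_sq, Complex.I_sq]
      field_simp
  rw [fourierFun, h2, ← Complex.ofReal_mul, ← mul_assoc]
  congr 3
  rw [neg_div, Real.rpow_neg (by positivity), ← Real.inv_rpow (by positivity),
    ← Real.mul_rpow (by positivity) (by positivity), Real.rpow_neg (by positivity),
    ← Real.inv_rpow (by positivity)]
  congr 1
  have := Real.pi_ne_zero
  field_simp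

theorem integral_gaussian_mul_fourier {t : ℝ} (ht : 0 < t) (u : 𝓢(Euc n, ℂ)) :
    ∫ w, ((Real.exp (-t * ‖w‖ ^ 2) : ℝ) : ℂ) * fourier n u w =
      (((2 * t) ^ (-(n : ℝ) / 2) : ℝ) : ℂ) *
        ∫ y, ((Real.exp (-(4 * t)⁻¹ * ‖y‖ ^ 2) : ℝ) : ℂ) * u y := by
  rw [← fourierFun_coe, integral_mul_fourierFun (integrable_gaussian ht) u.integrable,
    ← MeasureTheory.integral_const_mul]
  refine MeasureTheory.integral_congr_ae (Filter.Eventually.of_forall fun y => ?_)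
  beta_reduce
  rw [fourierFun_gaussian ht]
  push_cast
  ring

/-! ### The Fourier transform of the homogeneous kernel -/

theorem integral_rpow_mul_exp_neg_div {b s : ℝ} (hb : 0 < b) (hs : 0 < s) :
    MeasureTheory.IntegrableOn (fun t : ℝ => t ^ (-s - 1) * Real.exp (-b / t)) (Set.Ioi 0) ∧
      ∫ t in Set.Ioi (0 : ℝ), t ^ (-s - 1) * Real.exp (-b / t) = (1 / b) ^ s * Real.Gamma s := by
  have hsub : Set.EqOn (fun t : ℝ => (|(-1 : ℝ)| * t ^ ((-1 : ℝ) - 1)) •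
      ((t ^ (-1 : ℝ)) ^ (s - 1) * Real.exp (-(b * t ^ (-1 : ℝ)))))
      (fun t : ℝ => t ^ (-s - 1) * Real.exp (-b / t)) (Set.Ioi 0) := by
    intro t ht
    have ht' : 0 < t := ht
    beta_reduce
    rw [abs_neg, abs_one, one_mul, smul_eq_mul, ← mul_assoc, ← Real.rpow_mul ht'.le,
      ← Real.rpow_add ht', Real.rpow_neg_one]
    congr 2
    · ring
    · ring
  have h1 := Real.integral_rpow_mul_exp_neg_mul_Ioi hs hb
  have h2 : MeasureTheory.IntegrableOn (fun t : ℝ => t ^ (s - 1) * Real.exp (-(b * t)))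
      (Set.Ioi 0) := by
    have := integrableOn_rpow_mul_exp_neg_mul_rpow (p := 1) (s := s - 1) (b := b) (by linarith)
      one_pos hb
    simpa [neg_mul] using this
  refine ⟨?_, ?_⟩
  · have := (MeasureTheory.integrableOn_Ioi_comp_rpow_iff
      (fun t : ℝ => t ^ (s - 1) * Real.exp (-(b * t))) (p := -1) (by norm_num)).2 h2
    exact this.congr_fun hsub measurableSet_Ioi
  · have := MeasureTheory.integral_comp_rpow_Ioi
      (fun t : ℝ => t ^ (s - 1) * Real.exp (-(b * t))) (p := -1) (by norm_num)
    rw [MeasureTheory.setIntegral_congr_fun measurableSet_Ioi hsub] at this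
    rw [this, h1]

/-- The summands of a derivative of the heat kernel, with the density of the subordination
integral. -/
def heatTerm (n p r : ℕ) (t c : ℝ) : ℝ :=
  t ^ ((p : ℝ) + ((n : ℝ) - 1) / 2 - 1) * (2 * t) ^ (-(n : ℝ) / 2) *
    ((-(4 * t)⁻¹) ^ r * Real.exp (-(4 * t)⁻¹ * c ^ 2))

/-- The constant in the integral of `heatTerm`. -/
def heatConst (n p : ℕ) : ℝ :=
  (2 : ℝ) ^ (1 - (p : ℝ) - (n : ℝ) / 2) * Real.sqrt Real.pi /
    (Nat.doubleFactorial (2 * p - 1) : ℝ)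

theorem heatTerm_eq (n p r : ℕ) {t : ℝ} (ht : 0 < t) (c : ℝ) :
    heatTerm n p r t c = (2 : ℝ) ^ (-(n : ℝ) / 2) * ((-1) ^ r * ((4 : ℝ) ^ r)⁻¹) *
      (t ^ (-((r : ℝ) - p + 1 / 2) - 1) * Real.exp (-(c ^ 2 / 4) / t)) := by
  have h1 : t ^ (-((r : ℝ) - p + 1 / 2) - 1) =
      t ^ ((p : ℝ) + ((n : ℝ) - 1) / 2 - 1) * t ^ (-(n : ℝ) / 2) * (t ^ r)⁻¹ := by
    rw [← Real.rpow_natCast t r, ← Real.rpow_neg ht.le, ← Real.rpow_add ht, ← Real.rpow_add ht]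
    congr 1
    ring
  have h2 : -(4 * t)⁻¹ * c ^ 2 = -(c ^ 2 / 4) / t := by field_simp
  rw [heatTerm, h1, h2, Real.mul_rpow (by norm_num) ht.le, neg_pow, inv_pow, mul_pow]
  field_simp

theorem heatTerm_integral (n : ℕ) {p r : ℕ} (hpr : p ≤ r) {c : ℝ} (hc : 0 < c) :
    MeasureTheory.IntegrableOn (fun t => heatTerm n p r t c) (Set.Ioi 0) ∧
      ∫ t in Set.Ioi (0 : ℝ), heatTerm n p r t c =
        (-1) ^ p * heatConst n p * (halfDesc p r * c ^ (2 * (p : ℤ) - 1 - 2 * r)) := by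
  obtain ⟨j, rfl⟩ := Nat.exists_eq_add_of_le hpr
  have hs : (0 : ℝ) < ((p + j : ℕ) : ℝ) - p + 1 / 2 := by push_cast; simp; positivity
  obtain ⟨h1, h2⟩ := integral_rpow_mul_exp_neg_div (b := c ^ 2 / 4) (by positivity) hs
  have heq : Set.EqOn (fun t => heatTerm n p (p + j) t c) _ (Set.Ioi 0) :=
    fun t ht => heatTerm_eq n p (p + j) ht c
  refine ⟨MeasureTheory.IntegrableOn.congr_fun (h1.const_mul _) heq.symm measurableSet_Ioi, ?_⟩
  rw [MeasureTheory.setIntegral_congr_fun measurableSet_Ioi heq,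
    MeasureTheory.integral_const_mul, h2, halfDesc_eq, heatConst]
  have hsj : (((p + j : ℕ) : ℝ) - p + 1 / 2) = j + 1 / 2 := by push_cast; ring
  have h3 : (1 / (c ^ 2 / 4)) ^ ((j : ℝ) + 1 / 2) =
      2 * 4 ^ j * c ^ (2 * (p : ℤ) - 1 - 2 * ((p + j : ℕ) : ℤ)) := by
    rw [show 1 / (c ^ 2 / 4) = (2 / c) ^ (2 : ℝ) by rw [Real.rpow_two]; field_simp; norm_num,
      ← Real.rpow_mul (by positivity),
      show (2 : ℝ) * (j + 1 / 2) = ((2 * j + 1 : ℕ) : ℝ) by push_cast; ring, Real.rpow_natCast,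
      show 2 * (p : ℤ) - 1 - 2 * ((p + j : ℕ) : ℤ) = -((2 * j + 1 : ℕ) : ℤ) by push_cast; ring,
      zpow_neg, zpow_natCast, div_pow, pow_succ 2 (2 * j), pow_mul]
    norm_num
    ring
  have h4 : (2 : ℝ) ^ (1 - (p : ℝ) - (n : ℝ) / 2) =
      2 * (2 ^ p)⁻¹ * (2 : ℝ) ^ (-(n : ℝ) / 2) := by
    rw [show 1 - (p : ℝ) - (n : ℝ) / 2 = 1 + -(p : ℝ) + -(n : ℝ) / 2 by ring,
      Real.rpow_add two_pos, Real.rpow_add two_pos, Real.rpow_one, Real.rpow_neg zero_le_two,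
      Real.rpow_natCast]
  have hpi : Real.sqrt Real.pi ≠ 0 := (Real.sqrt_pos.2 Real.pi_pos).ne'
  have hdf : (Nat.doubleFactorial (2 * p - 1) : ℝ) ≠ 0 := by
    exact_mod_cast (Nat.doubleFactorial_pos _).ne'
  rw [hsj, h3, h4, pow_add, pow_add, show (4 : ℝ) ^ p = 2 ^ p * 2 ^ p by
    rw [← mul_pow]; norm_num]
  field_simp

theorem norm_heatTerm (n p r : ℕ) {t : ℝ} (ht : 0 < t) (c : ℝ) :
    ‖heatTerm n p r t c‖ = (-1) ^ r * heatTerm n p r t c := by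
  have h : (-1 : ℝ) ^ r * heatTerm n p r t c = (2 : ℝ) ^ (-(n : ℝ) / 2) * ((4 : ℝ) ^ r)⁻¹ *
      (t ^ (-((r : ℝ) - p + 1 / 2) - 1) * Real.exp (-(c ^ 2 / 4) / t)) := by
    rw [heatTerm_eq n p r ht]
    have : (-1 : ℝ) ^ r * (-1) ^ r = 1 := by rw [← mul_pow]; simp
    linear_combination ((2 : ℝ) ^ (-(n : ℝ) / 2) * ((4 : ℝ) ^ r)⁻¹ *
      (t ^ (-((r : ℝ) - p + 1 / 2) - 1) * Real.exp (-(c ^ 2 / 4) / t))) * this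
  have h0 : 0 ≤ (-1 : ℝ) ^ r * heatTerm n p r t c := by rw [h]; positivity
  rw [← Real.norm_of_nonneg h0, norm_mul, norm_pow, norm_neg, norm_one, one_pow, one_mul]

theorem integral_norm_heatTerm_mul (n : ℕ) {p r : ℕ} (hpr : p ≤ r) (a b : ℂ) {c : ℝ} (hc : 0 < c) :
    ∫ t in Set.Ioi (0 : ℝ), ‖a * (heatTerm n p r t c : ℂ) * b‖ =
      ‖a * (((-1) ^ r * ((-1) ^ p * heatConst n p * halfDesc p r) : ℝ) : ℂ) *
        ((c ^ (2 * (p : ℤ) - 1 - 2 * r) : ℝ) : ℂ) * b‖ := by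
  obtain ⟨-, h3⟩ := heatTerm_integral n hpr hc
  have h4 : ∫ t in Set.Ioi (0 : ℝ), ‖heatTerm n p r t c‖ =
      (-1) ^ r * ((-1) ^ p * heatConst n p * halfDesc p r) * c ^ (2 * (p : ℤ) - 1 - 2 * r) := by
    rw [MeasureTheory.setIntegral_congr_fun measurableSet_Ioi
      fun t ht => norm_heatTerm n p r ht c, MeasureTheory.integral_const_mul, h3]
    ring
  have h5 : 0 ≤ ∫ t in Set.Ioi (0 : ℝ), ‖heatTerm n p r t c‖ :=
    MeasureTheory.integral_nonneg fun _ => norm_nonneg _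
  simp only [norm_mul, Complex.norm_real]
  rw [MeasureTheory.integral_mul_const, MeasureTheory.integral_const_mul, mul_assoc ‖a‖,
    ← Real.norm_of_nonneg h5, h4]
  simp only [norm_mul]
  ring

theorem measurable_heatTerm (n p r : ℕ) :
    Measurable (fun q : Euc n × ℝ => heatTerm n p r q.2 ‖q.1‖) := by
  unfold heatTerm
  fun_prop

theorem integrable_heatTerm_mul {p r : ℕ} (hpr : p ≤ r) {g : Euc n → ℂ} (hg : Continuous g)
    {q : Euc n → ℂ} (hq : IsTest q) :
    MeasureTheory.Integrable (fun z : Euc n × ℝ => g z.1 * (heatTerm n p r z.2 ‖z.1‖ : ℂ) * q z.1)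
      (MeasureTheory.volume.prod (MeasureTheory.volume.restrict (Set.Ioi 0))) := by
  rw [MeasureTheory.integrable_prod_iff]
  · refine ⟨Filter.Eventually.of_forall fun y => ?_, ?_⟩
    · rcases eq_or_ne y 0 with rfl | hy
      · have : q 0 = 0 := image_eq_zero_of_notMem_tsupport fun h => hq.off h rfl
        simp [this]
      · have : MeasureTheory.Integrable (fun t : ℝ => (heatTerm n p r t ‖y‖ : ℂ))
            (MeasureTheory.volume.restrict (Set.Ioi 0)) :=
          Complex.ofRealCLM.integrable_comp (heatTerm_integral n hpr (norm_pos_iff.2 hy)).1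
        exact (this.const_mul (g y)).mul_const (q y)
    · have h1 : MeasureTheory.Integrable (fun y => ‖(g y *
          (((-1) ^ r * ((-1) ^ p * heatConst n p * halfDesc p r) : ℝ) : ℂ) *
            normPow (2 * (p : ℤ) - 1 - 2 * r) y) * q y‖) := by
        refine (hq.integrable_mul ?_).norm
        exact (hg.continuousOn.mul continuousOn_const).mul (smoothOff_normPow _).continuousOn
      refine h1.congr (Filter.Eventually.of_forall fun y => ?_)
      rcases eq_or_ne y 0 with rfl | hy
      · have : q 0 = 0 := image_eq_zero_of_notMem_tsupport fun h => hq.off h rfl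
        simp [this]
      · exact (integral_norm_heatTerm_mul n hpr (g y) (q y) (norm_pos_iff.2 hy)).symm
  · refine Measurable.aestronglyMeasurable ?_
    exact (((hg.measurable.comp measurable_fst).mul
      (Complex.measurable_ofReal.comp (measurable_heatTerm n p r)))).mul
      (hq.smooth.continuous.measurable.comp measurable_fst)

/-- Subordination: a negative power of the norm as a superposition of Gaussians. -/
theorem integral_gaussian_subordination (hn : 2 ≤ n) (p : ℕ) {w : Euc n} (hw : w ≠ 0) :
    MeasureTheory.IntegrableOn (fun t : ℝ => t ^ ((p : ℝ) + ((n : ℝ) - 1) / 2 - 1) *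
      Real.exp (-t * ‖w‖ ^ 2)) (Set.Ioi 0) ∧
    ∫ t in Set.Ioi (0 : ℝ), t ^ ((p : ℝ) + ((n : ℝ) - 1) / 2 - 1) * Real.exp (-t * ‖w‖ ^ 2) =
      Real.Gamma ((p : ℝ) + ((n : ℝ) - 1) / 2) * ‖w‖ ^ (-(2 * (p : ℤ)) - n + 1) := by
  have hn' : (2 : ℝ) ≤ n := by exact_mod_cast hn
  have ha : (0 : ℝ) < (p : ℝ) + ((n : ℝ) - 1) / 2 := by
    have : (0 : ℝ) ≤ p := p.cast_nonneg
    linarith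
  have hw' : 0 < ‖w‖ := norm_pos_iff.2 hw
  have hcomm : ∀ t : ℝ, -t * ‖w‖ ^ 2 = -(‖w‖ ^ 2 * t) := fun t => by ring
  simp only [hcomm]
  refine ⟨?_, ?_⟩
  · have := integrableOn_rpow_mul_exp_neg_mul_rpow (p := 1)
      (s := (p : ℝ) + ((n : ℝ) - 1) / 2 - 1) (b := ‖w‖ ^ 2) (by linarith) one_pos (by positivity)
    simpa [neg_mul] using this
  · rw [Real.integral_rpow_mul_exp_neg_mul_Ioi ha (by positivity), mul_comm]
    congr 1
    rw [one_div, Real.inv_rpow (by positivity), ← Real.rpow_neg (by positivity),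
      ← Real.rpow_natCast, ← Real.rpow_mul (by positivity), ← Real.rpow_intCast]
    congr 1
    push_cast
    ring

theorem integral_rayKernel_mul_fourier (hn : 2 ≤ n) {p : ℕ} {R : List (Fin n)}
    (hR : R.length = 2 * p) {q : 𝓢(Euc n, ℂ)} (hq : IsTest q) :
    (Real.Gamma ((p : ℝ) + ((n : ℝ) - 1) / 2) : ℂ) * ∫ w, rayKernel R w * fourier n q w =
      (heatConst n p : ℂ) * ∫ y, iterDeriv R (normPow (2 * p - 1)) y * q y := by
  set a : ℝ := (p : ℝ) + ((n : ℝ) - 1) / 2 with ha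
  obtain ⟨C, hC0, hC⟩ := exists_decay (fourier n q)
  have hk := integrable_rayKernel_mul hn R (fourier n q).continuous.measurable hC
  have hae : ∀ᵐ w : Euc n, w ≠ 0 := by
    have := nontrivial_euc hn
    exact MeasureTheory.Measure.ae_ne _ 0
  -- the subordination integral and its absolute convergence
  have hsub : ∀ w : Euc n, w ≠ 0 →
      ∫ t in Set.Ioi (0 : ℝ), ((t ^ (a - 1) * Real.exp (-t * ‖w‖ ^ 2) : ℝ) : ℂ) *
        (mono R w * fourier n q w) = (Real.Gamma a : ℂ) * (rayKernel R w * fourier n q w) := by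
    intro w hw
    rw [MeasureTheory.integral_mul_const, integral_complex_ofReal,
      (integral_gaussian_subordination hn p hw).2, rayKernel, normPow, hR]
    push_cast
    ring
  have hint1 : MeasureTheory.Integrable (fun z : Euc n × ℝ =>
      ((z.2 ^ (a - 1) * Real.exp (-z.2 * ‖z.1‖ ^ 2) : ℝ) : ℂ) * (mono R z.1 * fourier n q z.1))
      (MeasureTheory.volume.prod (MeasureTheory.volume.restrict (Set.Ioi 0))) := by
    rw [MeasureTheory.integrable_prod_iff]
    · refine ⟨?_, ?_⟩
      · filter_upwards [hae] with w hw
        have : MeasureTheory.Integrable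
            (fun t : ℝ => ((t ^ (a - 1) * Real.exp (-t * ‖w‖ ^ 2) : ℝ) : ℂ))
            (MeasureTheory.volume.restrict (Set.Ioi 0)) :=
          Complex.ofRealCLM.integrable_comp (integral_gaussian_subordination hn p hw).1
        exact this.mul_const (mono R w * fourier n q w)
      · refine (hk.norm.const_mul ‖Real.Gamma a‖).congr ?_
        filter_upwards [hae] with w hw
        have h1 : ∫ t in Set.Ioi (0 : ℝ), ‖((t ^ (a - 1) * Real.exp (-t * ‖w‖ ^ 2) : ℝ) : ℂ) *
            (mono R w * fourier n q w)‖ = (Real.Gamma a * ‖w‖ ^ (-(2 * (p : ℤ)) - n + 1)) *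
              ‖mono R w * fourier n q w‖ := by
          rw [← (integral_gaussian_subordination hn p hw).2, ← MeasureTheory.integral_mul_const]
          refine MeasureTheory.setIntegral_congr_fun measurableSet_Ioi fun t ht => ?_
          have ht' : 0 < t := ht
          rw [norm_mul, Complex.norm_real, Real.norm_of_nonneg (by positivity)]
        refine Eq.trans ?_ h1.symm
        have h2 : 0 ≤ Real.Gamma a := by
          refine Real.Gamma_nonneg_of_nonneg ?_
          have hn' : (2 : ℝ) ≤ n := by exact_mod_cast hn
          have : (0 : ℝ) ≤ p := p.cast_nonneg
          linarith
        rw [Real.norm_of_nonneg h2, rayKernel, normPow, hR]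
        simp only [norm_mul, Complex.norm_real, norm_zpow, norm_norm]
        push_cast
        ring
    · refine Measurable.aestronglyMeasurable ?_
      have h1 := (contDiff_mono R).continuous.measurable
      have h2 := (fourier n q).continuous.measurable
      fun_prop
  -- the expansion of the derivatives of the heat kernel
  have hinner : ∀ t ∈ Set.Ioi (0 : ℝ),
      ∫ w : Euc n, ((t ^ (a - 1) * Real.exp (-t * ‖w‖ ^ 2) : ℝ) : ℂ) *
        (mono R w * fourier n q w) =
      (-1) ^ p * ∫ y, ∑ r ∈ Finset.range (R.reverse.length + 1),
        polyEval (radialCoeff R.reverse r) y * (heatTerm n p r t ‖y‖ : ℂ) * q y := by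
    intro t ht
    have hsm : ContDiff ℝ ∞ (fun z : Euc n => ((Real.exp (-(4 * t)⁻¹ * ‖z‖ ^ 2) : ℝ) : ℂ)) :=
      Complex.ofRealCLM.contDiff.comp
        (Real.contDiff_exp.comp (contDiff_const.mul (contDiff_norm_sq ℝ)))
    have hparts := hsm.smoothOff.integral_iterDeriv_mul hq R.reverse
    rw [List.length_reverse, hR, pow_mul, neg_one_sq, one_pow, one_mul, List.reverse_reverse,
      ← coe_schwartzDeriv] at hparts
    have hI : (-Complex.I) ^ R.length = (-1) ^ p := by
      rw [hR, pow_mul, neg_sq, Complex.I_sq]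
    calc ∫ w : Euc n, ((t ^ (a - 1) * Real.exp (-t * ‖w‖ ^ 2) : ℝ) : ℂ) *
          (mono R w * fourier n q w)
        = ((t ^ (a - 1) : ℝ) : ℂ) * (-1) ^ p * ∫ w : Euc n, ((Real.exp (-t * ‖w‖ ^ 2) : ℝ) : ℂ) *
            fourier n (schwartzDeriv R q) w := by
          rw [← MeasureTheory.integral_const_mul]
          refine MeasureTheory.integral_congr_ae (Filter.Eventually.of_forall fun w => ?_)
          beta_reduce
          rw [mono_mul_fourier, hI]
          push_cast
          ring
      _ = (-1) ^ p * (((t ^ (a - 1) : ℝ) : ℂ) * (((2 * t) ^ (-(n : ℝ) / 2) : ℝ) : ℂ) *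
            ∫ y, iterDeriv R.reverse
              (fun z => ((Real.exp (-(4 * t)⁻¹ * ‖z‖ ^ 2) : ℝ) : ℂ)) y * q y) := by
          rw [integral_gaussian_mul_fourier ht, hparts]
          ring
      _ = _ := by
          rw [← MeasureTheory.integral_const_mul]
          congr 1
          refine MeasureTheory.integral_congr_ae (Filter.Eventually.of_forall fun y => ?_)
          beta_reduce
          rcases eq_or_ne y 0 with rfl | hy
          · have : q 0 = 0 := image_eq_zero_of_notMem_tsupport fun h => hq.off h rfl
            simp [this]
          · rw [iterDeriv_gaussian _ _ hy, Finset.sum_mul, Finset.mul_sum]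
            refine Finset.sum_congr rfl fun r _ => ?_
            rw [heatTerm]
            push_cast
            ring
  have hint2 : ∀ r ∈ Finset.range (R.reverse.length + 1),
      MeasureTheory.Integrable (fun z : Euc n × ℝ =>
        polyEval (radialCoeff R.reverse r) z.1 * (heatTerm n p r z.2 ‖z.1‖ : ℂ) * q z.1)
      (MeasureTheory.volume.prod (MeasureTheory.volume.restrict (Set.Ioi 0))) := by
    intro r _
    rcases Nat.lt_or_ge r p with hr | hr
    · rw [radialCoeff_eq_zero_of_lt R.reverse (by rw [List.length_reverse]; omega)]
      simp [polyEval]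
    · exact integrable_heatTerm_mul hr (contDiff_polyEval _).continuous hq
  have houter : ∀ y : Euc n, ∫ t in Set.Ioi (0 : ℝ),
      ∑ r ∈ Finset.range (R.reverse.length + 1),
        polyEval (radialCoeff R.reverse r) y * (heatTerm n p r t ‖y‖ : ℂ) * q y =
      (-1) ^ p * (heatConst n p : ℂ) * (iterDeriv R (normPow (2 * p - 1)) y * q y) := by
    intro y
    rcases eq_or_ne y 0 with rfl | hy
    · have : q 0 = 0 := image_eq_zero_of_notMem_tsupport fun h => hq.off h rfl
      simp [this]
    have hy' : 0 < ‖y‖ := norm_pos_iff.2 hy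
    rw [← iterDeriv_perm (smoothOff_normPow _) R.reverse_perm hy, iterDeriv_normPow p _ hy,
      MeasureTheory.integral_finsetSum, Finset.sum_mul, Finset.mul_sum]
    · refine Finset.sum_congr rfl fun r _ => ?_
      rcases Nat.lt_or_ge r p with hr | hr
      · rw [radialCoeff_eq_zero_of_lt R.reverse (by rw [List.length_reverse]; omega)]
        simp [polyEval]
      · rw [MeasureTheory.integral_mul_const, MeasureTheory.integral_const_mul,
          integral_complex_ofReal, (heatTerm_integral n hr hy').2, normPow]
        push_cast
        ring
    · intro r _
      rcases Nat.lt_or_ge r p with hr | hr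
      · rw [radialCoeff_eq_zero_of_lt R.reverse (by rw [List.length_reverse]; omega)]
        simp [polyEval]
      · have : MeasureTheory.Integrable (fun t : ℝ => (heatTerm n p r t ‖y‖ : ℂ))
            (MeasureTheory.volume.restrict (Set.Ioi 0)) :=
          Complex.ofRealCLM.integrable_comp (heatTerm_integral n hr hy').1
        exact (this.const_mul _).mul_const _
  calc (Real.Gamma a : ℂ) * ∫ w, rayKernel R w * fourier n q w
      = ∫ w : Euc n, ∫ t in Set.Ioi (0 : ℝ),
          ((t ^ (a - 1) * Real.exp (-t * ‖w‖ ^ 2) : ℝ) : ℂ) * (mono R w * fourier n q w) := by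
        rw [← MeasureTheory.integral_const_mul]
        refine MeasureTheory.integral_congr_ae ?_
        filter_upwards [hae] with w hw
        exact (hsub w hw).symm
    _ = ∫ t in Set.Ioi (0 : ℝ), ∫ w : Euc n,
          ((t ^ (a - 1) * Real.exp (-t * ‖w‖ ^ 2) : ℝ) : ℂ) * (mono R w * fourier n q w) :=
        MeasureTheory.integral_integral_swap (f := fun (w : Euc n) (t : ℝ) =>
          ((t ^ (a - 1) * Real.exp (-t * ‖w‖ ^ 2) : ℝ) : ℂ) * (mono R w * fourier n q w)) hint1
    _ = (-1) ^ p * ∫ t in Set.Ioi (0 : ℝ), ∫ y, ∑ r ∈ Finset.range (R.reverse.length + 1),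
          polyEval (radialCoeff R.reverse r) y * (heatTerm n p r t ‖y‖ : ℂ) * q y := by
        rw [MeasureTheory.setIntegral_congr_fun measurableSet_Ioi hinner,
          MeasureTheory.integral_const_mul]
    _ = (-1) ^ p * ∫ y, ∫ t in Set.Ioi (0 : ℝ), ∑ r ∈ Finset.range (R.reverse.length + 1),
          polyEval (radialCoeff R.reverse r) y * (heatTerm n p r t ‖y‖ : ℂ) * q y := by
        rw [MeasureTheory.integral_integral_swap (f := fun (y : Euc n) (t : ℝ) =>
          ∑ r ∈ Finset.range (R.reverse.length + 1),
            polyEval (radialCoeff R.reverse r) y * (heatTerm n p r t ‖y‖ : ℂ) * q y)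
          (MeasureTheory.integrable_finsetSum _ hint2)]
    _ = _ := by
        rw [MeasureTheory.integral_congr_ae (Filter.Eventually.of_forall houter),
          MeasureTheory.integral_const_mul, ← mul_assoc, ← mul_assoc, ← mul_pow]
        simp

/-! ### Convolution with the homogeneous kernel -/

/-- The function `2 ∫ w_R |w|^{-|R|-n+1} h(x + w) dw`. -/
def rayConv (R : List (Fin n)) (h : 𝓢(Euc n, ℂ)) (x : Euc n) : ℂ :=
  2 * ∫ w, rayKernel R w * h (x + w)

theorem stronglyMeasurable_rayConv (R : List (Fin n)) (h : 𝓢(Euc n, ℂ)) :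
    MeasureTheory.StronglyMeasurable (rayConv R h) := by
  have h1 : Measurable (fun z : Euc n × Euc n => rayKernel R z.2 * h (z.1 + z.2)) :=
    ((measurable_rayKernel R).comp measurable_snd).mul
      (h.continuous.measurable.comp (measurable_fst.add measurable_snd))
  exact (h1.stronglyMeasurable.integral_prod_right (ν := MeasureTheory.volume)).const_mul 2

theorem exists_rayConv_bound (hn : 2 ≤ n) (R : List (Fin n)) (h : 𝓢(Euc n, ℂ)) :
    ∃ C : ℝ, ∀ x, ‖rayConv R h x‖ ≤ C * (1 + ‖x‖) ^ 2 := by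
  obtain ⟨C, hC0, hC⟩ := exists_decay_shift h
  refine ⟨2 * (C * ∫ w : Euc n, weight w), fun x => ?_⟩
  have h1 : ‖∫ w, rayKernel R w * h (x + w)‖ ≤ ∫ w : Euc n, C * (1 + ‖x‖) ^ 2 * weight w := by
    refine MeasureTheory.norm_integral_le_of_norm_le ((integrable_weight hn).const_mul _)
      (Filter.Eventually.of_forall fun w => ?_)
    rw [norm_mul, weight, mul_left_comm]
    exact mul_le_mul (norm_rayKernel_le hn R w) (hC x w) (norm_nonneg _) (by positivity)
  rw [MeasureTheory.integral_const_mul] at h1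
  rw [rayConv, norm_mul, Complex.norm_ofNat]
  nlinarith [h1]

theorem integrable_one_add_pow_mul (N : ℕ) (g : 𝓢(Euc n, ℂ)) :
    MeasureTheory.Integrable (fun x => (1 + ‖x‖) ^ N * ‖g x‖) := by
  have h : ∀ x : Euc n, (1 + ‖x‖) ^ N * ‖g x‖ =
      ∑ j ∈ Finset.range (N + 1), (N.choose j : ℝ) * (‖x‖ ^ j * ‖g x‖) := by
    intro x
    rw [add_comm, add_pow, Finset.sum_mul]
    refine Finset.sum_congr rfl fun j _ => ?_
    rw [one_pow]
    ring
  simp only [h]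
  exact MeasureTheory.integrable_finsetSum _ fun j _ =>
    (g.integrable_pow_mul MeasureTheory.volume j).const_mul _

theorem fourierFun_shift (h : 𝓢(Euc n, ℂ)) (w y : Euc n) :
    fourierFun (fun x => h (x + w)) y =
      Complex.exp (Complex.I * ((inner ℝ y w : ℝ) : ℂ)) * fourier n h y := by
  rw [fourierFun, fourier_apply, mul_left_comm]
  congr 1
  rw [← MeasureTheory.integral_const_mul, ← MeasureTheory.integral_add_right_eq_self (fun x =>
    Complex.exp (Complex.I * ((inner ℝ y w : ℝ) : ℂ)) *
      (Complex.exp (-Complex.I * ((inner ℝ y x : ℝ) : ℂ)) * h x)) w]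
  refine MeasureTheory.integral_congr_ae (Filter.Eventually.of_forall fun x => ?_)
  beta_reduce
  rw [← mul_assoc, ← Complex.exp_add, inner_add_right]
  congr 2
  push_cast
  ring

theorem integral_shift_mul_fourier (h ψ : 𝓢(Euc n, ℂ)) (w : Euc n) :
    ∫ x, h (x + w) * fourier n ψ x = (((2 * Real.pi) ^ ((n : ℝ) / 2) : ℝ) : ℂ) *
      fourier n (SchwartzMap.pairing (ContinuousLinearMap.mul ℂ ℂ) (fourier n h) ψ) (-w) := by
  have hs : MeasureTheory.Integrable (fun x => h (x + w)) := h.integrable.comp_add_right w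
  rw [← fourierFun_coe ψ, integral_mul_fourierFun hs ψ.integrable, fourier_apply, ← mul_assoc,
    ← Complex.ofReal_mul, ← Real.rpow_add (by positivity), neg_div, add_neg_cancel,
    Real.rpow_zero, Complex.ofReal_one, one_mul]
  refine MeasureTheory.integral_congr_ae (Filter.Eventually.of_forall fun y => ?_)
  beta_reduce
  rw [fourierFun_shift, SchwartzMap.pairing_apply_apply, inner_neg_left, real_inner_comm]
  simp only [ContinuousLinearMap.mul_apply']
  push_cast
  rw [neg_mul_neg]
  ring

/-- The constant relating the convolution with the kernel and the derivatives of `|y|^{2p-1}`. -/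
def rayConst (n p : ℕ) : ℝ :=
  ((2 : ℝ) ^ ((p : ℤ) - 2) * (Nat.doubleFactorial (2 * p - 1) : ℝ) *
    Real.Gamma ((2 * (p : ℝ) + (n : ℝ) - 1) / 2) / Real.pi ^ (((n : ℝ) + 1) / 2))⁻¹

theorem gamma_pos (hn : 2 ≤ n) (p : ℕ) : 0 < Real.Gamma ((2 * (p : ℝ) + (n : ℝ) - 1) / 2) := by
  refine Real.Gamma_pos_of_pos ?_
  have hn' : (2 : ℝ) ≤ n := by exact_mod_cast hn
  have : (0 : ℝ) ≤ p := p.cast_nonneg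
  linarith

theorem rayConst_mul_gamma (hn : 2 ≤ n) (p : ℕ) :
    2 * (2 * Real.pi) ^ ((n : ℝ) / 2) * heatConst n p =
      rayConst n p * Real.Gamma ((p : ℝ) + ((n : ℝ) - 1) / 2) := by
  have hG := (gamma_pos hn p).ne'
  have hdf : (Nat.doubleFactorial (2 * p - 1) : ℝ) ≠ 0 := by
    exact_mod_cast (Nat.doubleFactorial_pos _).ne'
  rw [show (p : ℝ) + ((n : ℝ) - 1) / 2 = (2 * (p : ℝ) + (n : ℝ) - 1) / 2 by ring, rayConst,
    heatConst]
  have h1 : Real.pi ^ (((n : ℝ) + 1) / 2) = Real.pi ^ ((n : ℝ) / 2) * Real.sqrt Real.pi := by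
    rw [Real.sqrt_eq_rpow, ← Real.rpow_add Real.pi_pos]; congr 1; ring
  have h2 : (2 : ℝ) ^ (1 - (p : ℝ) - (n : ℝ) / 2) =
      2 * (2 ^ p)⁻¹ * ((2 : ℝ) ^ ((n : ℝ) / 2))⁻¹ := by
    rw [show 1 - (p : ℝ) - (n : ℝ) / 2 = 1 + -(p : ℝ) + -((n : ℝ) / 2) by ring,
      Real.rpow_add two_pos, Real.rpow_add two_pos, Real.rpow_one, Real.rpow_neg zero_le_two,
      Real.rpow_neg zero_le_two, Real.rpow_natCast]
  have h3 : (2 : ℝ) ^ ((p : ℤ) - 2) = 2 ^ p / 4 := by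
    rw [zpow_sub₀ two_ne_zero, zpow_natCast]; norm_num
  have h4 : (2 : ℝ) ^ ((n : ℝ) / 2) ≠ 0 := by positivity
  have h5 : Real.pi ^ ((n : ℝ) / 2) ≠ 0 := by positivity
  rw [h1, h2, h3, Real.mul_rpow zero_le_two Real.pi_pos.le]
  field_simp
  norm_num

theorem integral_rayConv_mul_fourier (hn : 2 ≤ n) {p : ℕ} {R : List (Fin n)}
    (hR : R.length = 2 * p) (h : 𝓢(Euc n, ℂ)) {ψ : 𝓢(Euc n, ℂ)} (hψ : IsTest ψ) :
    ∫ x, rayConv R h x * fourier n ψ x =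
      (rayConst n p : ℂ) * ∫ y, iterDeriv R (normPow (2 * p - 1)) y * (fourier n h y * ψ y) := by
  set q := SchwartzMap.pairing (ContinuousLinearMap.mul ℂ ℂ) (fourier n h) ψ with hqdef
  have hqc : ⇑q = fun y => fourier n h y * ψ y := by
    funext y; simp [hqdef, SchwartzMap.pairing_apply_apply]
  have hsub : tsupport q ⊆ tsupport ψ := by rw [hqc]; exact tsupport_mul_subset_right
  have hq : IsTest q := ⟨q.smooth ⊤,
    hψ.compact.of_isClosed_subset (isClosed_tsupport _) hsub, hsub.trans hψ.off⟩
  obtain ⟨C, hC0, hC⟩ := exists_decay_shift h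
  have hint : MeasureTheory.Integrable (fun z : Euc n × Euc n =>
      rayKernel R z.2 * h (z.1 + z.2) * fourier n ψ z.1)
      (MeasureTheory.volume.prod MeasureTheory.volume) := by
    refine (((integrable_one_add_pow_mul 2 (fourier n ψ)).mul_prod
      (integrable_weight hn)).const_mul C).mono' ?_ (Filter.Eventually.of_forall fun z => ?_)
    · refine Measurable.aestronglyMeasurable ?_
      exact (((measurable_rayKernel R).comp measurable_snd).mul
        (h.continuous.measurable.comp (measurable_fst.add measurable_snd))).mul
        ((fourier n ψ).continuous.measurable.comp measurable_fst)
    · rw [norm_mul, norm_mul, weight]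
      calc ‖rayKernel R z.2‖ * ‖h (z.1 + z.2)‖ * ‖fourier n ψ z.1‖
          ≤ (‖z.2‖ ^ (n - 1))⁻¹ * (C * (1 + ‖z.1‖) ^ 2 * ((1 + ‖z.2‖) ^ 2)⁻¹) *
              ‖fourier n ψ z.1‖ := by
            gcongr
            · exact norm_rayKernel_le hn R _
            · exact hC _ _
        _ = _ := by ring
  have hG : (Real.Gamma ((p : ℝ) + ((n : ℝ) - 1) / 2) : ℂ) ≠ 0 := by
    have := (gamma_pos hn p).ne'
    rw [show (2 * (p : ℝ) + (n : ℝ) - 1) / 2 = (p : ℝ) + ((n : ℝ) - 1) / 2 by ring] at this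
    exact_mod_cast this
  have h1 : ∫ x, rayConv R h x * fourier n ψ x =
      2 * ((((2 * Real.pi) ^ ((n : ℝ) / 2) : ℝ) : ℂ) * ∫ w, rayKernel R w * fourier n q w) := by
    calc ∫ x, rayConv R h x * fourier n ψ x
        = 2 * ∫ x, ∫ w, rayKernel R w * h (x + w) * fourier n ψ x := by
          rw [← MeasureTheory.integral_const_mul]
          refine MeasureTheory.integral_congr_ae (Filter.Eventually.of_forall fun x => ?_)
          beta_reduce
          rw [rayConv, MeasureTheory.integral_mul_const, mul_assoc]
      _ = 2 * ∫ w, ∫ x, rayKernel R w * h (x + w) * fourier n ψ x := by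
          rw [MeasureTheory.integral_integral_swap
            (f := fun x w => rayKernel R w * h (x + w) * fourier n ψ x) hint]
      _ = 2 * ∫ w, (((2 * Real.pi) ^ ((n : ℝ) / 2) : ℝ) : ℂ) *
            (rayKernel R (-w) * fourier n q (-w)) := by
          congr 1
          refine MeasureTheory.integral_congr_ae (Filter.Eventually.of_forall fun w => ?_)
          beta_reduce
          simp only [mul_assoc]
          rw [MeasureTheory.integral_const_mul, integral_shift_mul_fourier,
            rayKernel_neg ⟨p, by omega⟩]
          ring
      _ = _ := by
          rw [MeasureTheory.integral_const_mul,
            MeasureTheory.integral_neg_eq_self (fun w => rayKernel R w * fourier n q w)]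
  have h2 := integral_rayKernel_mul_fourier hn hR hq
  have h3 : (2 : ℂ) * (((2 * Real.pi) ^ ((n : ℝ) / 2) : ℝ) : ℂ) * (heatConst n p : ℂ) =
      (rayConst n p : ℂ) * (Real.Gamma ((p : ℝ) + ((n : ℝ) - 1) / 2) : ℂ) := by
    exact_mod_cast congrArg (fun t : ℝ => (t : ℂ)) (rayConst_mul_gamma hn p)
  rw [hqc] at h2
  rw [h1]
  refine mul_left_cancel₀ hG ?_
  linear_combination (2 * (((2 * Real.pi) ^ ((n : ℝ) / 2) : ℝ) : ℂ)) * h2 +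
    (∫ y, iterDeriv R (normPow (2 * p - 1)) y * (fourier n h y * ψ y)) * h3

/-! ### Tempered distributions defined by functions of polynomial growth -/

theorem integrable_mul_of_bound {u : Euc n → ℂ}
    (hu : MeasureTheory.AEStronglyMeasurable u MeasureTheory.volume) {C : ℝ} {N : ℕ}
    (hC : ∀ x, ‖u x‖ ≤ C * (1 + ‖x‖) ^ N) (φ : 𝓢(Euc n, ℂ)) :
    MeasureTheory.Integrable (fun x => u x * φ x) := by
  refine ((integrable_one_add_pow_mul N φ).const_mul C).mono'
    (hu.mul φ.continuous.aestronglyMeasurable) (Filter.Eventually.of_forall fun x => ?_)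
  rw [norm_mul, ← mul_assoc]
  exact mul_le_mul_of_nonneg_right (hC x) (norm_nonneg _)

theorem exists_isDefinedBy {u : Euc n → ℂ}
    (hu : MeasureTheory.AEStronglyMeasurable u MeasureTheory.volume) {C : ℝ} {N : ℕ}
    (hC : ∀ x, ‖u x‖ ≤ C * (1 + ‖x‖) ^ N) : ∃ U : 𝓢'(Euc n, ℂ), IsDefinedBy U u := by
  have hC0 : 0 ≤ C := by simpa using (norm_nonneg _).trans (hC 0)
  have hint := integrable_mul_of_bound hu hC
  obtain ⟨d, hd⟩ :=
    (inferInstance : (MeasureTheory.volume : MeasureTheory.Measure (Euc n)).HasTemperateGrowth)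
      |>.exists_integrable
  let A : 𝓢(Euc n, ℂ) →L[ℂ] ℂ := by
    refine SchwartzMap.mkCLMtoNormedSpace (fun φ => ∫ x, u x * φ x) ?_ ?_ ?_
    · intro φ ψ
      simp only [add_apply, mul_add]
      exact MeasureTheory.integral_add (hint φ) (hint ψ)
    · intro c φ
      simp only [smul_apply, smul_eq_mul, mul_left_comm _ c]
      exact MeasureTheory.integral_const_mul c _
    · refine ⟨Finset.Iic (N + d, 0),
        C * (2 ^ (N + d) * ∫ x : Euc n, (1 + ‖x‖) ^ (-(d : ℝ))), by positivity, fun φ => ?_⟩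
      have h1 : ∀ x, ‖u x * φ x‖ ≤ C * (2 ^ (N + d) *
          (Finset.Iic (N + d, 0)).sup (schwartzSeminormFamily ℂ (Euc n) ℂ) φ) *
            (1 + ‖x‖) ^ (-(d : ℝ)) := by
        intro x
        have h2 := SchwartzMap.one_add_le_sup_seminorm_apply (𝕜 := ℂ) (m := (N + d, 0))
          (k := N + d) (n := 0) le_rfl le_rfl φ x
        rw [norm_iteratedFDeriv_zero] at h2
        change _ ≤ 2 ^ (N + d) *
          (Finset.Iic (N + d, 0)).sup (schwartzSeminormFamily ℂ (Euc n) ℂ) φ at h2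
        rw [norm_mul, Real.rpow_neg (by positivity), Real.rpow_natCast, ← div_eq_mul_inv,
          le_div_iff₀ (by positivity)]
        calc ‖u x‖ * ‖φ x‖ * (1 + ‖x‖) ^ d
            ≤ C * (1 + ‖x‖) ^ N * ‖φ x‖ * (1 + ‖x‖) ^ d := by gcongr; exact hC x
          _ = C * ((1 + ‖x‖) ^ (N + d) * ‖φ x‖) := by rw [pow_add]; ring
          _ ≤ _ := by gcongr
      refine (MeasureTheory.norm_integral_le_of_norm_le (hd.const_mul _)
        (Filter.Eventually.of_forall h1)).trans (le_of_eq ?_)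
      rw [MeasureTheory.integral_const_mul]
      ring
  exact ⟨ContinuousLinearMap.toPointwiseConvergenceCLM _ _ _ _ A, fun φ => ⟨hint φ, rfl⟩⟩

/-! ### The normal operator as a sum of convolutions -/

theorem inner_pow_eq_sum (k : ℕ) (x ξ : Euc n) :
    ((inner ℝ x ξ : ℝ) : ℂ) ^ k =
      ∑ K : Fin k → Fin n, mono (List.ofFn K) x * mono (List.ofFn K) ξ := by
  have h : ((inner ℝ x ξ : ℝ) : ℂ) = ∑ l, ((x l : ℝ) : ℂ) * ((ξ l : ℝ) : ℂ) := by
    rw [PiLp.inner_apply]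
    push_cast
    exact Finset.sum_congr rfl fun l _ => by simp [mul_comm]
  rw [h, Fintype.sum_pow]
  refine Finset.sum_congr rfl fun K _ => ?_
  rw [mono_ofFn, mono_ofFn, Finset.prod_mul_distrib]

theorem integrable_line (h : 𝓢(Euc n, ℂ)) (x : Euc n) (ξ : Metric.sphere (0 : Euc n) 1) :
    MeasureTheory.Integrable (fun s : ℝ => h (x + s • (ξ : Euc n))) := by
  obtain ⟨C, hC0, hC⟩ := exists_decay_shift h
  refine (integrable_inv_one_add_sq.const_mul (C * (1 + ‖x‖) ^ 2)).mono'
    (h.continuous.comp (by fun_prop)).aestronglyMeasurable (Filter.Eventually.of_forall fun s => ?_)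
  have := hC x (s • (ξ : Euc n))
  rwa [norm_smul, norm_eq_of_mem_sphere ξ, mul_one] at this

theorem momentumRay_lineThrough (k : ℕ) (f : (Fin m → Fin n) → 𝓢(Euc n, ℂ)) (x : Euc n)
    (ξ : Metric.sphere (0 : Euc n) 1) :
    momentumRay k f (lineThrough x ξ) = ∑ J : Fin m → Fin n, ∑ K : Fin k → Fin n,
      mono (List.ofFn J ++ List.ofFn K) (ξ : Euc n) *
        ∫ s : ℝ, schwartzMono (List.ofFn K) (f J) (x + s • (ξ : Euc n)) := by
  have hξ : ‖(ξ : Euc n)‖ = 1 := norm_eq_of_mem_sphere ξ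
  have h1 : momentumRay k f (lineThrough x ξ) = ∫ s : ℝ, ∑ J : Fin m → Fin n,
      ∑ K : Fin k → Fin n, mono (List.ofFn J ++ List.ofFn K) (ξ : Euc n) *
        schwartzMono (List.ofFn K) (f J) (x + s • (ξ : Euc n)) := by
    rw [momentumRay, ← MeasureTheory.integral_add_right_eq_self _ (inner ℝ x (ξ : Euc n))]
    refine MeasureTheory.integral_congr_ae (Filter.Eventually.of_forall fun s => ?_)
    have h2 : x - (inner ℝ x (ξ : Euc n) : ℝ) • (ξ : Euc n) +
        (s + inner ℝ x (ξ : Euc n)) • (ξ : Euc n) = x + s • (ξ : Euc n) := by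
      rw [add_smul]; abel
    have h3 : s + inner ℝ x (ξ : Euc n) = inner ℝ (x + s • (ξ : Euc n)) (ξ : Euc n) := by
      rw [inner_add_left, real_inner_smul_left, real_inner_self_eq_norm_sq, hξ]; ring
    simp only [lineThrough, h2]
    rw [h3, inner_pow_eq_sum, Finset.mul_sum]
    refine Finset.sum_congr rfl fun J _ => ?_
    rw [Finset.sum_mul]
    refine Finset.sum_congr rfl fun K _ => ?_
    rw [schwartzMono_apply, mono_append, mono_ofFn J]
    ring
  rw [h1, MeasureTheory.integral_finsetSum]
  · refine Finset.sum_congr rfl fun J _ => ?_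
    rw [MeasureTheory.integral_finsetSum]
    · exact Finset.sum_congr rfl fun K _ => MeasureTheory.integral_const_mul _ _
    · exact fun K _ => (integrable_line _ x ξ).const_mul _
  · exact fun J _ => MeasureTheory.integrable_finsetSum _ fun K _ =>
      (integrable_line _ x ξ).const_mul _

theorem normalOp_eq_sum (hn : 2 ≤ n) (k : ℕ) (f : (Fin m → Fin n) → 𝓢(Euc n, ℂ)) (x : Euc n)
    (i : Fin m → Fin n) :
    normalOp k f x i = ∑ K : Fin k → Fin n, ∑ J : Fin m → Fin n, ∑ K' : Fin k → Fin n,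
      mono (List.ofFn K) x *
        rayConv (List.ofFn K ++ List.ofFn i ++ (List.ofFn J ++ List.ofFn K'))
          (schwartzMono (List.ofFn K') (f J)) x := by
  choose C hC0 hC using fun (J : Fin m → Fin n) (K' : Fin k → Fin n) =>
    exists_decay_shift (schwartzMono (List.ofFn K') (f J))
  have hmain := fun (K : Fin k → Fin n) (J : Fin m → Fin n) (K' : Fin k → Fin n) =>
    integral_sphere_line hn
      (R := List.ofFn K ++ List.ofFn i ++ (List.ofFn J ++ List.ofFn K'))
      (h := fun w => schwartzMono (List.ofFn K') (f J) (x + w))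
      ⟨k + m, by simp only [List.length_append, List.length_ofFn]; ring⟩
      ((SchwartzMap.continuous _).comp (continuous_const.add continuous_id))
      (C := C J K' * (1 + ‖x‖) ^ 2) (hC J K' x)
  have h1 : normalOp k f x i = ∫ ξ : Metric.sphere (0 : Euc n) 1,
      (∑ K : Fin k → Fin n, ∑ J : Fin m → Fin n, ∑ K' : Fin k → Fin n,
        mono (List.ofFn K) x *
          (mono (List.ofFn K ++ List.ofFn i ++ (List.ofFn J ++ List.ofFn K')) (ξ : Euc n) *
            ∫ s : ℝ, schwartzMono (List.ofFn K') (f J) (x + s • (ξ : Euc n))))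
      ∂(MeasureTheory.volume : MeasureTheory.Measure (Euc n)).toSphere := by
    refine MeasureTheory.integral_congr_ae (Filter.Eventually.of_forall fun ξ => ?_)
    beta_reduce
    rw [momentumRay_lineThrough, inner_pow_eq_sum, Finset.sum_mul, Finset.sum_mul]
    refine Finset.sum_congr rfl fun K _ => ?_
    rw [Finset.mul_sum]
    refine Finset.sum_congr rfl fun J _ => ?_
    rw [Finset.mul_sum]
    refine Finset.sum_congr rfl fun K' _ => ?_
    rw [mono_append (_ ++ _), mono_append (List.ofFn K) (List.ofFn i), mono_ofFn i]
    ring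
  rw [h1, MeasureTheory.integral_finsetSum]
  · refine Finset.sum_congr rfl fun K _ => ?_
    rw [MeasureTheory.integral_finsetSum]
    · refine Finset.sum_congr rfl fun J _ => ?_
      rw [MeasureTheory.integral_finsetSum]
      · refine Finset.sum_congr rfl fun K' _ => ?_
        rw [MeasureTheory.integral_const_mul, (hmain K J K').2, rayConv]
      · exact fun K' _ => (hmain K J K').1.const_mul _
    · exact fun J _ => MeasureTheory.integrable_finsetSum _ fun K' _ =>
        (hmain K J K').1.const_mul _
  · exact fun K _ => MeasureTheory.integrable_finsetSum _ fun J _ =>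
      MeasureTheory.integrable_finsetSum _ fun K' _ => (hmain K J K').1.const_mul _

theorem exists_mono_mul_rayConv_bound (hn : 2 ≤ n) (K R : List (Fin n)) (h : 𝓢(Euc n, ℂ)) :
    ∃ C : ℝ, ∀ x, ‖mono K x * rayConv R h x‖ ≤ C * (1 + ‖x‖) ^ (K.length + 2) := by
  obtain ⟨C, hC⟩ := exists_rayConv_bound hn R h
  refine ⟨C, fun x => ?_⟩
  rw [norm_mul, pow_add, mul_left_comm]
  refine mul_le_mul ((norm_mono_le K x).trans ?_) (hC x) (norm_nonneg _) (by positivity)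
  exact pow_le_pow_left₀ (norm_nonneg _) (by linarith) _

theorem exists_isDefinedBy_normalOp (hn : 2 ≤ n) (k : ℕ) (f : (Fin m → Fin n) → 𝓢(Euc n, ℂ))
    (i : Fin m → Fin n) : ∃ U : 𝓢'(Euc n, ℂ), IsDefinedBy U (fun x => normalOp k f x i) := by
  simp only [normalOp_eq_sum hn]
  choose C hC using fun (K : Fin k → Fin n) (J : Fin m → Fin n) (K' : Fin k → Fin n) =>
    exists_mono_mul_rayConv_bound hn (List.ofFn K)
      (List.ofFn K ++ List.ofFn i ++ (List.ofFn J ++ List.ofFn K'))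
      (schwartzMono (List.ofFn K') (f J))
  refine exists_isDefinedBy (N := k + 2) (C := ∑ K, ∑ J, ∑ K', C K J K') ?_ fun x => ?_
  · refine MeasureTheory.StronglyMeasurable.aestronglyMeasurable ?_
    refine Finset.stronglyMeasurable_fun_sum _ fun K _ => Finset.stronglyMeasurable_fun_sum _
      fun J _ => Finset.stronglyMeasurable_fun_sum _ fun K' _ => ?_
    exact (contDiff_mono _).continuous.stronglyMeasurable.mul (stronglyMeasurable_rayConv _ _)
  · simp only [Finset.sum_mul]
    refine (norm_sum_le _ _).trans (Finset.sum_le_sum fun K _ => ?_)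
    refine (norm_sum_le _ _).trans (Finset.sum_le_sum fun J _ => ?_)
    refine (norm_sum_le _ _).trans (Finset.sum_le_sum fun K' _ => ?_)
    have := hC K J K' x
    rwa [List.length_ofFn] at this

theorem integral_normalOp_mul_fourier (hn : 2 ≤ n) (k : ℕ) (f : (Fin m → Fin n) → 𝓢(Euc n, ℂ))
    (i : Fin m → Fin n) {φ : 𝓢(Euc n, ℂ)} (hφ : IsTest φ) :
    ∫ x, normalOp k f x i * fourier n φ x =
      ∑ K : Fin k → Fin n, ∑ J : Fin m → Fin n, ∑ K' : Fin k → Fin n, (rayConst n (m + k) : ℂ) *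
        ∫ y, iterDeriv (List.ofFn K ++ List.ofFn i ++ (List.ofFn J ++ List.ofFn K'))
            (normPow (2 * (m + k : ℕ) - 1)) y *
          (iterDeriv (List.ofFn K') (fourier n (f J)) y * iterDeriv (List.ofFn K) φ y) := by
  have hint : ∀ (K : Fin k → Fin n) (J : Fin m → Fin n) (K' : Fin k → Fin n),
      MeasureTheory.Integrable (fun x => mono (List.ofFn K) x *
        rayConv (List.ofFn K ++ List.ofFn i ++ (List.ofFn J ++ List.ofFn K'))
          (schwartzMono (List.ofFn K') (f J)) x * fourier n φ x) := by
    intro K J K'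
    obtain ⟨C, hC⟩ := exists_mono_mul_rayConv_bound hn (List.ofFn K)
      (List.ofFn K ++ List.ofFn i ++ (List.ofFn J ++ List.ofFn K'))
      (schwartzMono (List.ofFn K') (f J))
    exact integrable_mul_of_bound ((contDiff_mono _).continuous.stronglyMeasurable.mul
      (stronglyMeasurable_rayConv _ _)).aestronglyMeasurable hC _
  simp only [normalOp_eq_sum hn, Finset.sum_mul]
  rw [MeasureTheory.integral_finsetSum _ fun K _ => MeasureTheory.integrable_finsetSum _ fun J _ =>
    MeasureTheory.integrable_finsetSum _ fun K' _ => hint K J K']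
  refine Finset.sum_congr rfl fun K _ => ?_
  rw [MeasureTheory.integral_finsetSum _ fun J _ =>
    MeasureTheory.integrable_finsetSum _ fun K' _ => hint K J K']
  refine Finset.sum_congr rfl fun J _ => ?_
  rw [MeasureTheory.integral_finsetSum _ fun K' _ => hint K J K']
  refine Finset.sum_congr rfl fun K' _ => ?_
  have htest : IsTest (schwartzDeriv (List.ofFn K) φ) := by
    rw [coe_schwartzDeriv]; exact hφ.iterDeriv _
  have hlen : (List.ofFn K ++ List.ofFn i ++ (List.ofFn J ++ List.ofFn K')).length =
      2 * (m + k) := by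
    simp only [List.length_append, List.length_ofFn]; ring
  have key := integral_rayConv_mul_fourier hn hlen (schwartzMono (List.ofFn K') (f J)) htest
  calc ∫ x, mono (List.ofFn K) x *
        rayConv (List.ofFn K ++ List.ofFn i ++ (List.ofFn J ++ List.ofFn K'))
          (schwartzMono (List.ofFn K') (f J)) x * fourier n φ x
      = (-Complex.I) ^ k * ∫ x,
          rayConv (List.ofFn K ++ List.ofFn i ++ (List.ofFn J ++ List.ofFn K'))
            (schwartzMono (List.ofFn K') (f J)) x *
          fourier n (schwartzDeriv (List.ofFn K) φ) x := by
        rw [← MeasureTheory.integral_const_mul]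
        refine MeasureTheory.integral_congr_ae (Filter.Eventually.of_forall fun x => ?_)
        beta_reduce
        have := mono_mul_fourier (List.ofFn K) φ x
        rw [List.length_ofFn] at this
        rw [mul_left_comm, ← this]
        ring
    _ = _ := by
        rw [key, mul_left_comm, ← MeasureTheory.integral_const_mul]
        congr 1
        refine MeasureTheory.integral_congr_ae (Filter.Eventually.of_forall fun y => ?_)
        beta_reduce
        rw [fourier_schwartzMono, coe_schwartzDeriv, List.length_ofFn]
        have hI : (-Complex.I) ^ k * Complex.I ^ k = 1 := by rw [← mul_pow]; simp
        linear_combination (iterDeriv (List.ofFn K ++ List.ofFn i ++ (List.ofFn J ++ List.ofFn K'))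
            (normPow (2 * (m + k : ℕ) - 1)) y *
          (iterDeriv (List.ofFn K') (fourier n (f J)) y * iterDeriv (List.ofFn K) φ y)) * hI

/-! ### The symbol field -/

theorem rayConst_succ (hn : 2 ≤ n) (p : ℕ) :
    rayConst n (p + 1) * ((2 * p + 1) * (2 * p + n - 1)) = rayConst n p := by
  have hG := (gamma_pos hn p).ne'
  have hdf : (Nat.doubleFactorial (2 * p - 1) : ℝ) ≠ 0 := by
    exact_mod_cast (Nat.doubleFactorial_pos _).ne'
  have hn' : (2 : ℝ) ≤ n := by exact_mod_cast hn
  have hp : (0 : ℝ) ≤ p := p.cast_nonneg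
  have h0 : (2 * (p : ℝ) + n - 1) ≠ 0 := by
    have : 0 < 2 * (p : ℝ) + n - 1 := by linarith
    exact this.ne'
  have h1 : Real.Gamma ((2 * ((p + 1 : ℕ) : ℝ) + n - 1) / 2) =
      (2 * (p : ℝ) + n - 1) / 2 * Real.Gamma ((2 * (p : ℝ) + n - 1) / 2) := by
    rw [← Real.Gamma_add_one (by simpa using h0)]
    congr 1
    push_cast
    ring
  have h2 : (Nat.doubleFactorial (2 * (p + 1) - 1) : ℝ) =
      (2 * p + 1) * (Nat.doubleFactorial (2 * p - 1) : ℝ) := by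
    cases p with
    | zero => simp
    | succ p =>
      rw [show 2 * (p + 1 + 1) - 1 = (2 * (p + 1) - 1) + 2 by omega, Nat.doubleFactorial_add_two,
        show 2 * (p + 1) - 1 + 2 = 2 * (p + 1) + 1 by omega]
      push_cast
      ring
  have h3 : (2 : ℝ) ^ (((p + 1 : ℕ) : ℤ) - 2) = 2 * 2 ^ ((p : ℤ) - 2) := by
    rw [show ((p + 1 : ℕ) : ℤ) - 2 = ((p : ℤ) - 2) + 1 by push_cast; ring,
      zpow_add_one₀ two_ne_zero, mul_comm]
  have h4 : (2 : ℝ) ^ ((p : ℤ) - 2) ≠ 0 := by positivity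
  have h5 : Real.pi ^ (((n : ℝ) + 1) / 2) ≠ 0 := by positivity
  have h6 : (2 * (p : ℝ) + 1) ≠ 0 := by positivity
  rw [rayConst, rayConst, h1, h2, h3]
  field_simp

/-- The field `∂_{X J K} (κ_p |y|^{2p-1}) ∂_K F_J` of rank `2p - m - k`, where `κ_p` is
`rayConst n p`. -/
def symbolField (F : (Fin m → Fin n) → Euc n → ℂ) (k p : ℕ) (X : List (Fin n)) (y : Euc n) : ℂ :=
  if X.length + (m + k) = 2 * p then
    (rayConst n p : ℂ) * ∑ J : Fin m → Fin n, ∑ K : Fin k → Fin n,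
      iterDeriv (X ++ (List.ofFn J ++ List.ofFn K)) (normPow (2 * p - 1)) y *
        iterDeriv (List.ofFn K) (F J) y
  else 0

theorem symField_symbolField {F : (Fin m → Fin n) → Euc n → ℂ} (hF : ∀ J, SmoothOff (F J))
    (k p : ℕ) : SymField (symbolField F k p) where
  perm {R R'} hR y hy := by
    rw [symbolField, symbolField, hR.length_eq]
    split_ifs
    · refine congrArg _ (Finset.sum_congr rfl fun J _ => Finset.sum_congr rfl fun K _ => ?_)
      rw [iterDeriv_perm (smoothOff_normPow _) (hR.append_right _) hy]
    · rfl
  smooth X := by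
    by_cases h : X.length + (m + k) = 2 * p
    · have : symbolField F k p X = fun y => (rayConst n p : ℂ) * ∑ J : Fin m → Fin n,
          ∑ K : Fin k → Fin n,
          iterDeriv (X ++ (List.ofFn J ++ List.ofFn K)) (normPow (2 * p - 1)) y *
            iterDeriv (List.ofFn K) (F J) y := by
        funext y; rw [symbolField, if_pos h]
      rw [this]
      exact (smoothOff_const _).mul (SmoothOff.sum fun J _ => SmoothOff.sum fun K _ =>
        ((smoothOff_normPow _).iterDeriv _).mul ((hF J).iterDeriv _))
    · have : symbolField F k p X = fun _ => 0 := by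
        funext y; rw [symbolField, if_neg h]
      rw [this]
      exact smoothOff_const 0

theorem posField_symbolField (F : (Fin m → Fin n) → Euc n → ℂ) (k p : ℕ) (X : List (Fin n))
    {y : Euc n} (hy : y ≠ 0) : posField (symbolField F k p) X y = 0 := by
  by_cases h : (X.length + 1) + (m + k) = 2 * p
  · have h1 : posField (symbolField F k p) X y = (rayConst n p : ℂ) * ∑ J : Fin m → Fin n,
        ∑ K : Fin k → Fin n, (∑ l, ((y l : ℝ) : ℂ) *
          iterDeriv (l :: (X ++ (List.ofFn J ++ List.ofFn K))) (normPow (2 * p - 1)) y) *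
            iterDeriv (List.ofFn K) (F J) y := by
      simp only [posField, symbolField, List.length_cons, if_pos h, Finset.mul_sum,
        Finset.sum_mul]
      rw [Finset.sum_comm]
      refine Finset.sum_congr rfl fun J _ => ?_
      rw [Finset.sum_comm]
      refine Finset.sum_congr rfl fun K _ => Finset.sum_congr rfl fun l _ => ?_
      rw [List.cons_append]
      ring
    rw [h1]
    simp_rw [euler_iterDeriv_normPow _ _ hy]
    have h2 : ∀ (J : Fin m → Fin n) (K : Fin k → Fin n),
        (2 * (p : ℤ) - 1 - ((X ++ (List.ofFn J ++ List.ofFn K)).length : ℤ)) = 0 := by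
      intro J K
      simp only [List.length_append, List.length_ofFn]
      omega
    simp_rw [h2]
    simp
  · simp [posField, symbolField, h]

theorem trField_symbolField (hn : 2 ≤ n) (F : (Fin m → Fin n) → Euc n → ℂ) (k p : ℕ)
    (X : List (Fin n)) {y : Euc n} (hy : y ≠ 0) :
    trField (symbolField F k (p + 1)) X y = symbolField F k p X y := by
  by_cases h : X.length + (m + k) = 2 * p
  · have h' : (X.length + 1 + 1) + (m + k) = 2 * (p + 1) := by omega
    have h1 : trField (symbolField F k (p + 1)) X y =
        (rayConst n (p + 1) : ℂ) * ∑ J : Fin m → Fin n, ∑ K : Fin k → Fin n,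
          (∑ l, iterDeriv (l :: l :: (X ++ (List.ofFn J ++ List.ofFn K)))
            (normPow (2 * (p + 1 : ℕ) - 1)) y) * iterDeriv (List.ofFn K) (F J) y := by
      simp only [trField, symbolField, List.length_cons, if_pos h', Finset.mul_sum,
        Finset.sum_mul]
      rw [Finset.sum_comm]
      refine Finset.sum_congr rfl fun J _ => ?_
      rw [Finset.sum_comm]
      refine Finset.sum_congr rfl fun K _ => Finset.sum_congr rfl fun l _ => ?_
      rw [List.cons_append, List.cons_append]
    rw [h1, symbolField, if_pos h, ← rayConst_succ hn p]
    simp_rw [trace_iterDeriv_normPow _ _ hy]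
    rw [show 2 * ((p + 1 : ℕ) : ℤ) - 1 - 2 = 2 * p - 1 by push_cast; ring]
    simp only [Finset.mul_sum]
    refine Finset.sum_congr rfl fun J _ => Finset.sum_congr rfl fun K _ => ?_
    push_cast
    ring
  · have h' : ¬ (X.length + 1 + 1) + (m + k) = 2 * (p + 1) := by omega
    simp [trField, symbolField, h, h']

theorem iterate_trField_symbolField (hn : 2 ≤ n) (F : (Fin m → Fin n) → Euc n → ℂ) (k p j : ℕ)
    (X : List (Fin n)) {y : Euc n} (hy : y ≠ 0) :
    trField^[j] (symbolField F k (p + j)) X y = symbolField F k p X y := by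
  induction j generalizing p X y with
  | zero => rfl
  | succ j ih =>
    rw [Function.iterate_succ_apply',
      trField_congr (S' := symbolField F k (p + 1)) ?_ X hy, trField_symbolField hn F k p X hy]
    intro X y hy
    have := ih (p + 1) X hy
    rwa [add_right_comm] at this

/-! ### Contractions of symmetric tensors -/

theorem ofFn_comp_cast {α : Type*} {a b : ℕ} (h : a = b) (i : Fin b → α) :
    List.ofFn (i ∘ Fin.cast h) = List.ofFn i := by
  subst h; rfl

theorem sum_mul_symmetrize {q : ℕ} {T : List (Fin n) → ℂ}
    (hT : ∀ {R R' : List (Fin n)}, R.Perm R' → T R = T R') (v : Tensor n q) :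
    ∑ j, T (List.ofFn j) * symmetrize v j = ∑ j, T (List.ofFn j) * v j := by
  have h1 : ∀ π : Equiv.Perm (Fin q),
      ∑ j : Fin q → Fin n, T (List.ofFn j) * v (j ∘ π) = ∑ j, T (List.ofFn j) * v j := by
    intro π
    refine Eq.trans (Finset.sum_congr rfl fun j _ => ?_)
      ((Equiv.arrowCongr π.symm (Equiv.refl (Fin n))).sum_comp fun j => T (List.ofFn j) * v j)
    have : Equiv.arrowCongr π.symm (Equiv.refl (Fin n)) j = j ∘ π := rfl
    rw [this, hT (Equiv.Perm.ofFn_comp_perm π j)]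
  simp only [symmetrize, Finset.mul_sum]
  rw [Finset.sum_comm]
  have h2 : ∀ π : Equiv.Perm (Fin q),
      ∑ j : Fin q → Fin n, T (List.ofFn j) * ((q.factorial : ℂ)⁻¹ * v (j ∘ π)) =
        (q.factorial : ℂ)⁻¹ * ∑ j, T (List.ofFn j) * v j := by
    intro π
    rw [← h1 π, Finset.mul_sum]
    exact Finset.sum_congr rfl fun j _ => by ring
  rw [Finset.sum_congr rfl fun π _ => h2 π, Finset.sum_const, Finset.card_univ,
    Fintype.card_perm, Fintype.card_fin, nsmul_eq_mul, ← mul_assoc, mul_inv_cancel₀ (by exact_mod_cast q.factorial_ne_zero), one_mul]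

theorem symmetrize_of_isSymm {q : ℕ} {v : Tensor n q} (hv : IsSymm v) : symmetrize v = v := by
  funext i
  rw [symmetrize, Finset.sum_congr rfl fun π _ => hv π i, Finset.sum_const, Finset.card_univ,
    Fintype.card_perm, Fintype.card_fin, nsmul_eq_mul, ← mul_assoc,
    inv_mul_cancel₀ (by exact_mod_cast q.factorial_ne_zero), one_mul]

theorem smoothOff_innerDerivPow {u : Euc n → Tensor n m} (hu : ∀ J, SmoothOff (fun z => u z J))
    (k : ℕ) (j : Fin (m + k) → Fin n) : SmoothOff (fun z => innerDerivPow k u z j) := by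
  induction k with
  | zero => exact hu j
  | succ k ih =>
    refine (smoothOff_const _).mul (SmoothOff.sum fun π _ => ?_)
    exact (ih _).partialDeriv _

theorem innerDerivPow_scalar {u : Euc n → ℂ} (hu : SmoothOff u) (N : ℕ)
    (j : Fin (0 + N) → Fin n) {y : Euc n} (hy : y ≠ 0) :
    innerDerivPow (m := 0) N (fun z _ => u z) y j = iterDeriv (List.ofFn j) u y := by
  induction N generalizing y with
  | zero => rfl
  | succ N ih =>
    have hsucc : ∀ i : Fin (0 + N + 1) → Fin n,
        partialDeriv (i (Fin.last (0 + N)))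
          (fun z => innerDerivPow (m := 0) N (fun z _ => u z) z (Fin.init i)) y =
        iterDeriv (List.ofFn i) u y := by
      intro i
      rw [partialDeriv_congr (fun z hz => ih (Fin.init i) hz) _ hy, ← iterDeriv_cons]
      refine iterDeriv_perm hu ?_ hy
      rw [List.ofFn_succ' i, List.concat_eq_append]
      exact (List.perm_append_singleton _ _).symm
    have hsymm : IsSymm (fun i : Fin (0 + N + 1) → Fin n => iterDeriv (List.ofFn i) u y) :=
      fun π i => iterDeriv_perm hu (Equiv.Perm.ofFn_comp_perm π i) hy
    exact (congrFun (congrArg symmetrize (funext hsucc)) j).trans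
      (congrFun (symmetrize_of_isSymm hsymm) j)

theorem sum_mul_innerDerivPow {u : Euc n → Tensor n m} (hu : ∀ J, SmoothOff (fun z => u z J))
    {T : List (Fin n) → ℂ} (hT : ∀ {R R' : List (Fin n)}, R.Perm R' → T R = T R') (k : ℕ)
    {y : Euc n} (hy : y ≠ 0) :
    ∑ j, T (List.ofFn j) * innerDerivPow k u y j = ∑ J : Fin m → Fin n, ∑ K : Fin k → Fin n,
      T (List.ofFn J ++ List.ofFn K) * iterDeriv (List.ofFn K) (fun z => u z J) y := by
  induction k generalizing T y with
  | zero => simp [innerDerivPow]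
  | succ k ih =>
    have h1 : ∑ j : Fin (m + k + 1) → Fin n, T (List.ofFn j) * innerDerivPow (k + 1) u y j =
        ∑ l, ∑ j : Fin (m + k) → Fin n, T (l :: List.ofFn j) *
          partialDeriv l (fun z => innerDerivPow k u z j) y := by
      refine (sum_mul_symmetrize hT _).trans ?_
      rw [← (Fin.snocEquiv fun _ : Fin (m + k + 1) => Fin n).sum_comp, Fintype.sum_prod_type]
      refine Finset.sum_congr rfl fun l _ => Finset.sum_congr rfl fun j _ => ?_
      have h2 : (Fin.snocEquiv fun _ : Fin (m + k + 1) => Fin n) (l, j) =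
        Fin.snoc (α := fun _ => Fin n) j l := rfl
      have h3 : partialDeriv (Fin.snoc (α := fun _ => Fin n) j l (Fin.last (m + k)))
          (fun z => innerDerivPow k u z (Fin.init (Fin.snoc (α := fun _ => Fin n) j l))) y =
          partialDeriv l (fun z => innerDerivPow k u z j) y := by
        rw [Fin.snoc_last, Fin.init_snoc]
      rw [h2]
      refine congrArg₂ (· * ·) (hT ?_) h3
      rw [List.ofFn_succ']
      simp only [Fin.snoc_castSucc, Fin.snoc_last, List.concat_eq_append]
      exact List.perm_append_singleton _ _
    refine h1.trans ?_
    have h3 : ∀ l : Fin n, ∑ j : Fin (m + k) → Fin n, T (l :: List.ofFn j) *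
          partialDeriv l (fun z => innerDerivPow k u z j) y =
        ∑ J : Fin m → Fin n, ∑ K : Fin k → Fin n, T (l :: (List.ofFn J ++ List.ofFn K)) *
          iterDeriv (l :: List.ofFn K) (fun z => u z J) y := by
      intro l
      have h4 := partialDeriv_congr (fun z hz =>
        ih (T := fun R => T (l :: R)) (fun hR => hT (hR.cons l)) (y := z) hz) l hy
      rw [partialDeriv_sum fun j _ => ((smoothOff_const _).mul
          (smoothOff_innerDerivPow hu k j)).differentiableAt hy,
        partialDeriv_sum fun J _ => (SmoothOff.sum fun K _ => (smoothOff_const _).mul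
          ((hu J).iterDeriv _)).differentiableAt hy] at h4
      rw [Finset.sum_congr rfl fun j _ => partialDeriv_const_mul
        ((smoothOff_innerDerivPow hu k j).differentiableAt hy) _ l] at h4
      rw [h4]
      refine Finset.sum_congr rfl fun J _ => ?_
      rw [partialDeriv_sum fun K _ => ((smoothOff_const _).mul
          ((hu J).iterDeriv _)).differentiableAt hy]
      exact Finset.sum_congr rfl fun K _ =>
        partialDeriv_const_mul (((hu J).iterDeriv _).differentiableAt hy) _ l
    simp_rw [h3]
    rw [Finset.sum_comm]
    refine Finset.sum_congr rfl fun J _ => ?_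
    rw [← (Fin.consEquiv fun _ : Fin (k + 1) => Fin n).sum_comp, Fintype.sum_prod_type]
    refine Finset.sum_congr rfl fun l _ => Finset.sum_congr rfl fun K _ => ?_
    have h5 : List.ofFn ((Fin.consEquiv fun _ : Fin (k + 1) => Fin n) (l, K)) =
        l :: List.ofFn K := by
      rw [List.ofFn_succ]; rfl
    rw [h5, hT (List.perm_middle)]

theorem contractVecPow_eq {r : ℕ} (k : ℕ) {S : List (Fin n) → Euc n → ℂ} (hS : SymField S)
    {y : Euc n} (hy : y ≠ 0) {v : Tensor n (r + k)} (hv : ∀ j, v j = S (List.ofFn j) y)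
    (i : Fin r → Fin n) : contractVecPow y k v i = posField^[k] S (List.ofFn i) y := by
  induction k generalizing S with
  | zero => exact hv i
  | succ k ih =>
    rw [Function.iterate_succ_apply]
    refine ih hS.posField fun j => ?_
    rw [contractVec, contract, posField, ← (Equiv.funUnique (Fin 1) (Fin n)).symm.sum_comp]
    refine Finset.sum_congr rfl fun l _ => ?_
    have h1 : v (Fin.append j ((Equiv.funUnique (Fin 1) (Fin n)).symm l) ∘ Fin.cast rfl) =
        S (l :: List.ofFn j) y := by
      refine (hv _).trans (hS.perm ?_ y hy)
      refine ((ofFn_comp_cast _ _).trans (List.ofFn_fin_append _ _)).symm ▸ ?_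
      exact List.perm_append_singleton _ _
    rw [h1, mul_comm]
    rfl

theorem tensorA_zero_apply (m : ℕ) {y : Euc n} (hy : y ≠ 0) (j : Fin (2 * m - 0) → Fin n) :
    tensorA n m 0 y j = iterDeriv (List.ofFn j) (normPow (2 * m - 1)) y := by
  have h := innerDerivPow_scalar (smoothOff_normPow (n := n) (2 * (m : ℤ) - 2 * ((0 : ℕ) : ℤ) - 1))
    (2 * m - 0) (j ∘ Fin.cast (zero_add _)) hy
  rw [ofFn_comp_cast] at h
  refine h.trans ?_
  simp

/-! ### The Fourier transform of the normal operator -/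

theorem SymField.const_mul {S : List (Fin n) → Euc n → ℂ} (h : SymField S) (c : ℂ) :
    SymField (fun X y => c * S X y) where
  perm hR y hy := by rw [h.perm hR y hy]
  smooth R := (smoothOff_const c).mul (h.smooth R)

/-- The Fourier transform of `N_m^k f` off the origin, as a family indexed by lists. -/
def normalSymbol (k : ℕ) (f : (Fin m → Fin n) → 𝓢(Euc n, ℂ)) (X : List (Fin n)) (y : Euc n) : ℂ :=
  (-1) ^ k * divField^[k] (symbolField (fun J => fourier n (f J)) k (m + k)) X y

theorem symField_symbolField_fourier (k p : ℕ) (f : (Fin m → Fin n) → 𝓢(Euc n, ℂ)) :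
    SymField (symbolField (fun J => fourier n (f J)) k p) :=
  symField_symbolField (fun J => ((fourier n (f J)).smooth ⊤).smoothOff) k p

theorem symField_normalSymbol (k : ℕ) (f : (Fin m → Fin n) → 𝓢(Euc n, ℂ)) :
    SymField (normalSymbol k f) :=
  ((symField_symbolField_fourier k (m + k) f).iterate_divField k).const_mul _

theorem integral_normalSymbol_mul (hn : 2 ≤ n) (k : ℕ) (f : (Fin m → Fin n) → 𝓢(Euc n, ℂ))
    (i : Fin m → Fin n) {φ : 𝓢(Euc n, ℂ)} (hφ : IsTest φ) :
    ∫ y, normalSymbol k f (List.ofFn i) y * φ y = ∫ x, normalOp k f x i * fourier n φ x := by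
  have h1 : ∫ y, normalSymbol k f (List.ofFn i) y * φ y = (-1) ^ k *
      ∫ y, divField^[k] (symbolField (fun J => fourier n (f J)) k (m + k)) (List.ofFn i) y * φ y := by
    rw [← MeasureTheory.integral_const_mul]
    simp only [normalSymbol, mul_assoc]
  rw [h1, integral_iterate_divField_mul (symField_symbolField_fourier k (m + k) f) hφ,
    ← mul_assoc, ← mul_pow, neg_one_mul, neg_neg, one_pow, one_mul,
    integral_normalOp_mul_fourier hn k f i hφ]
  refine Finset.sum_congr rfl fun K _ => ?_
  have hlen : (List.ofFn K ++ List.ofFn i).length + (m + k) = 2 * (m + k) := by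
    simp only [List.length_append, List.length_ofFn]; ring
  have hint : ∀ (J : Fin m → Fin n) (K' : Fin k → Fin n),
      MeasureTheory.Integrable (fun y => (rayConst n (m + k) : ℂ) *
        (iterDeriv (List.ofFn K ++ List.ofFn i ++ (List.ofFn J ++ List.ofFn K'))
          (normPow (2 * (m + k : ℕ) - 1)) y *
        (iterDeriv (List.ofFn K') (fourier n (f J)) y * iterDeriv (List.ofFn K) φ y))) := by
    intro J K'
    have := (hφ.iterDeriv (List.ofFn K)).integrable_mul
      (((smoothOff_normPow (2 * (m + k : ℕ) - 1)).iterDeriv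
        (List.ofFn K ++ List.ofFn i ++ (List.ofFn J ++ List.ofFn K'))).mul
      (((fourier n (f J)).smooth ⊤).smoothOff.iterDeriv (List.ofFn K'))).continuousOn
    simp only [mul_assoc] at this
    exact this.const_mul _
  simp_rw [← MeasureTheory.integral_const_mul]
  simp_rw [← MeasureTheory.integral_finsetSum Finset.univ fun K' _ => hint _ K']
  rw [← MeasureTheory.integral_finsetSum Finset.univ fun J _ =>
    MeasureTheory.integrable_finsetSum _ fun K' _ => hint J K']
  refine MeasureTheory.integral_congr_ae (Filter.Eventually.of_forall fun y => ?_)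
  simp only [symbolField, if_pos hlen, Finset.mul_sum, Finset.sum_mul]
  refine Finset.sum_congr rfl fun J _ => Finset.sum_congr rfl fun K' _ => ?_
  ring

theorem iterate_posField_normalSymbol (hn : 2 ≤ n) (k : ℕ) (f : (Fin m → Fin n) → 𝓢(Euc n, ℂ))
    (X : List (Fin n)) {y : Euc n} (hy : y ≠ 0) :
    posField^[k] (normalSymbol k f) X y =
      (k.factorial : ℂ) * symbolField (fun J => fourier n (f J)) k m X y := by
  have h1 : normalSymbol k f = fun X y => (-1 : ℂ) ^ k *
    divField^[k] (symbolField (fun J => fourier n (f J)) k (m + k)) X y := rfl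
  rw [h1, iterate_posField_const_mul]
  beta_reduce
  rw [iterate_posField_iterate_divField (symField_symbolField_fourier k (m + k) f)
    (fun X y hy => posField_symbolField _ k (m + k) X hy) k X hy,
    iterate_trField_symbolField hn _ k m k X hy, ← mul_assoc, ← mul_assoc, ← mul_pow]
  simp

theorem contract_tensorA_innerDerivPow {k : ℕ}
    (f : (Fin m → Fin n) → 𝓢(Euc n, ℂ)) {y : Euc n} (hy : y ≠ 0)
    (h : (m - k) + (m + k) = 2 * m - 0) (i : Fin (m - k) → Fin n) :
    (rayConst n m : ℂ) * contract h (tensorA n m 0 y)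
      (innerDerivPow k (fun z i => fourier n (f i) z) y) i =
        symbolField (fun J => fourier n (f J)) k m (List.ofFn i) y := by
  have hlen : (List.ofFn i).length + (m + k) = 2 * m := by
    rw [List.length_ofFn]; omega
  rw [symbolField, if_pos hlen, contract]
  congr 1
  have h1 : ∀ j : Fin (m + k) → Fin n, tensorA n m 0 y (Fin.append i j ∘ Fin.cast h.symm) =
      iterDeriv (List.ofFn i ++ List.ofFn j) (normPow (2 * m - 1)) y := by
    intro j
    rw [tensorA_zero_apply m hy, ofFn_comp_cast, List.ofFn_fin_append]
  simp_rw [h1]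
  exact sum_mul_innerDerivPow (u := fun z i => fourier n (f i) z)
    (T := fun R => iterDeriv (List.ofFn i ++ R) (normPow (2 * m - 1)) y)
    (fun J => ((fourier n (f J)).smooth ⊤).smoothOff)
    (fun hR => iterDeriv_perm (smoothOff_normPow _) (hR.append_left _) hy) k hy

theorem rayConst_ne_zero (hn : 2 ≤ n) (p : ℕ) : rayConst n p ≠ 0 := by
  have hG := gamma_pos hn p
  have hdf : (0 : ℝ) < Nat.doubleFactorial (2 * p - 1) := by
    exact_mod_cast Nat.doubleFactorial_pos _
  rw [rayConst]
  have := Real.pi_pos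
  positivity

theorem rayConst_mul_normalization (hn : 2 ≤ n) (m k : ℕ) :
    rayConst n m * ((2 : ℝ) ^ ((m : ℤ) - 2) * (Nat.doubleFactorial (2 * m - 1) : ℝ) *
      Real.Gamma ((2 * (m : ℝ) + (n : ℝ) - 1) / 2) /
        (Real.pi ^ (((n : ℝ) + 1) / 2) * (k.factorial : ℝ))) * (k.factorial : ℝ) = 1 := by
  have hG := (gamma_pos hn m).ne'
  have hdf : (Nat.doubleFactorial (2 * m - 1) : ℝ) ≠ 0 := by
    exact_mod_cast (Nat.doubleFactorial_pos _).ne'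
  have hpi : Real.pi ^ (((n : ℝ) + 1) / 2) ≠ 0 := (Real.rpow_pos_of_pos Real.pi_pos _).ne'
  have hkf : (k.factorial : ℝ) ≠ 0 := by exact_mod_cast k.factorial_ne_zero
  rw [rayConst]
  field_simp

end MomentumRay

end

open MomentumRay in
/-- For a Schwartz symmetric tensor field `f` of rank `m`, the field `N_m^k f` defines a tempered
tensor distribution `U`, whose Fourier transform is on `ℝⁿ ∖ {0}` a smooth symmetric tensor field
`G`, and `A^{(m,0)} / (d^k f̂) = F^{(m,k)}` on `ℝⁿ ∖ {0}`. -/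
theorem proposition4p4 (n m k : ℕ) (hn : 2 ≤ n) (hk : k ≤ m)
    (f : (Fin m → Fin n) → 𝓢(Euc n, ℂ)) (hf : IsSymm f) :
    ∃ (U : (Fin m → Fin n) → 𝓢'(Euc n, ℂ)) (G : Euc n → Tensor n m),
      (∀ i, IsDefinedBy (U i) (fun x => normalOp k f x i)) ∧
      (∀ i, RestrictsOffOriginTo (fourierDistribution (U i)) (fun y => G y i)) ∧
      ContDiffOn ℝ ∞ G {0}ᶜ ∧
      (∀ y : Euc n, y ≠ 0 → IsSymm (G y)) ∧
      ∀ y : Euc n, y ≠ 0 →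
        contract (show (m - k) + (m + k) = 2 * m - 0 by omega) (tensorA n m 0 y)
          (innerDerivPow k (fun z i => fourier n (f i) z) y) = tensorF hk G y := by
  choose U hU using exists_isDefinedBy_normalOp hn k f
  have hS := symField_normalSymbol k f
  refine ⟨U, fun y i => normalSymbol k f (List.ofFn i) y, hU, ?_, ?_, ?_, ?_⟩
  · intro i φ hφ1 hφ2
    have hφ : IsTest φ := ⟨φ.smooth ⊤, hφ1, hφ2⟩
    refine ⟨hφ.integrable_mul (hS.smooth _).continuousOn, ?_⟩
    rw [integral_normalSymbol_mul hn k f i hφ]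
    exact (hU i (fourier n φ)).2
  · exact contDiffOn_pi.2 fun i => hS.smooth _
  · exact fun y hy π i => hS.perm (Equiv.Perm.ofFn_comp_perm π i) y hy
  · intro y hy
    funext i
    have hc : (rayConst n m : ℂ) ≠ 0 := by exact_mod_cast rayConst_ne_zero hn m
    refine mul_left_cancel₀ hc ?_
    rw [contract_tensorA_innerDerivPow f hy, tensorF, Pi.smul_apply,
      contractVecPow_eq k hS hy (fun j => by rw [castRank, ofFn_comp_cast]) i,
      iterate_posField_normalSymbol hn k f _ hy, smul_eq_mul, ← mul_assoc, ← mul_assoc]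
    refine (one_mul _).symm.trans (congrArg (· * _) ?_)
    have h := congrArg Complex.ofReal (rayConst_mul_normalization hn m k)
    rw [Complex.ofReal_mul, Complex.ofReal_mul, Complex.ofReal_one, Complex.ofReal_natCast] at h
    exact h.symm
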